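/- Let $M$ be a smooth manifold of dimension $2n$ with a locally conformally symplectic structure: a nondegenerate smooth 2-form $\omega$ and a closed 1-form $\theta$ with $d\omega=-\omega\wedge\theta$. For $k\in\mathbb Z$ let $d_k\alpha=d\alpha+k\,\theta\wedge\alpha$ on $\Omega^*(M)$, let $H^j_k$ be the $j$-th (Lichnerowicz–Novikov) cohomology of $(\Omega^*(M),d_k)$ (with $\Omega^{-1}(M)=0$ and $H^{-1}_k=0$), and let $L\alpha=\omega\wedge\alpha$, so that $d_kL=Ld_{k-1}$. Let $F^p\Omega^m=L^p\Omega^{m-2p}(M)$ (zero if $m<2p$); this is a filtration stable under $d_k$. Put $E^{p,q}_{k,0}=F^p\Omega^{p+q}/F^{p+1}\Omega^{p+q}$ with the differential $d_{k,0}:E^{p,q}_{k,0}\to E^{p,q+1}_{k,0}$ induced by $d_k$, and let $E^{p,q}_{k,1}$ be its cohomology at $E^{p,q}_{k,0}$, i.e. the $E_1$-term of the spectral sequence of the filtered complex $(F^*\Omega^*,d_k)$. Let $\mathcal P^k\subset\Omega^k(M)$ be the space of primitive forms: $\mathcal P^k=\ker L^{n-k+1}$ if $k\le n$, and $\mathcal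 P^k=0$ if $k>n$. Then, for every $l\in\mathbb Z$: (1) $\Omega^k(M)=\mathcal P^k\oplus L\Omega^{k-2}(M)$ for $0\le k\le n$. Let $\Pi_{pr}:\Omega^k(M)\to\mathcal P^k$ be the corresponding projection (zero if $k>n$), and let $d_l^+=\Pi_{pr}d_l:\mathcal P^k\to\mathcal P^{k+1}$. (2) For $0\le p\le q\le n-1$, the assignment $[a]\mapsto[L^pa]$ ($a\in\mathcal P^{q-p}$, $d_l^+a=0$) is a well-defined linear isomorphism $H^{q-p}(\mathcal P^*,d_l^+)\cong E^{p,q}_{l+p,1}$. (3) For $0\le p\le q\le n-1$ the sequence $$\cdots\to H^{q-p}_l\xrightarrow{\bar L^p}E^{p,q}_{l+p,1}\xrightarrow{\delta_{p,q}}H^{q-p-1}_{l-1}\xrightarrow{\bar L}H^{q-p+1}_l\xrightarrow{\bar L^p}E^{p,q+1}_{l+p,1}\to\cdots$$ is exact, where $\bar L[\eta]=[L\eta]$, $\bar L^p[\beta]=[L^p\beta]$ and $\delta_{p,q}$ is the connecting homomorphism: every cocycle of $E^{p,q}_{l+p,0}$ is of the form $[L^p\alpha]$ with $\alpha\in\Omega^{q-p}(M)$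 and $d_l\alpha=L\eta$ for some $d_{l-1}$-closed $\eta\in\Omega^{q-p-1}(M)$, and $\delta_{p,q}$ sends its class to $[\eta]$ for every such choice. For fixed $p\le n-1$ the sequence begins, at $q=p$, with $0\to H^0_l\to E^{p,p}_{l+p,1}\to0\to H^1_l\to E^{p,p+1}_{l+p,1}\to\cdots$, and exactness is asserted at every term up to and including $H^{n-p}_l$, which is followed by $E^{p,n}_{l+p,1}$. -/

import Mathlib

open scoped Manifold ContDiff Topology

set_option maxSynthPendingDepth 3

noncomputable section

namespace LCS

section

open ContinuousAlternatingMap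
section
variable {E : Type*} [NormedAddCommGroup E] [NormedSpace ℝ E] {k : ℕ}

/-- Alternating `k`-forms on a normed space. -/
abbrev Alt (E : Type*) [NormedAddCommGroup E] [NormedSpace ℝ E] (k : ℕ) : Type _ :=
  E [⋀^Fin k]→L[ℝ] ℝ

/-- A `1`-form as a linear functional. -/
def oneForm (θ : Alt E 1) : E →L[ℝ] ℝ := (ofSubsingletonLIE (𝕜 := ℝ) (E := E) (F := ℝ) (0 : Fin 1)).symm θ

/-- The wedge product `θ ∧ α` of a `1`-form and a `k`-form (see `wedgeOne_apply`). -/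
def wedgeOne (θ : Alt E 1) (α : Alt E k) : Alt E (k + 1) :=
  alternatizeUncurryFin ((oneForm θ).smulRight α)

/-- The wedge product `σ ∧ α` of a `2`-form and a `k`-form, obtained by alternating
`(u, v) ↦ σ(u, v) α`. The explicit formula as a sum over `(2, k)`-shuffles is `wedgeTwo_apply`. -/
def wedgeTwo (σ : Alt E 2) (α : Alt E k) : Alt E (k + 2) :=
  (2⁻¹ : ℝ) • alternatizeUncurryFin (alternatizeUncurryFinCLM ℝ E ℝ ∘L
    ((ContinuousLinearMap.smulRightL ℝ E (Alt E k)).flip α ∘L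
      ((ofSubsingletonLIE (𝕜 := ℝ) (E := E) (F := ℝ) (0 : Fin 1)).symm : Alt E 1 →L[ℝ] E →L[ℝ] ℝ) ∘L σ.curryLeft))

theorem oneForm_apply (θ : Alt E 1) (v : E) : oneForm θ v = θ ![v] := by
  simp only [oneForm]
  show θ _ = _
  congr 1; ext i; fin_cases i; rfl

theorem wedgeOne_apply (θ : Alt E 1) (α : Alt E k) (v : Fin (k + 1) → E) :
    wedgeOne θ α v = ∑ i : Fin (k + 1), (-1) ^ (i : ℕ) * (θ ![v i] * α (i.removeNth v)) := by
  simp [wedgeOne, alternatizeUncurryFin_apply, oneForm_apply]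

theorem wedgeTwo_eq (σ : Alt E 2) (α : Alt E k) :
    wedgeTwo σ α = (2⁻¹ : ℝ) • alternatizeUncurryFin (alternatizeUncurryFinCLM ℝ E ℝ ∘L
    ((ContinuousLinearMap.smulRightL ℝ E (Alt E k)).flip α ∘L
      ((ofSubsingletonLIE (𝕜 := ℝ) (E := E) (F := ℝ) (0 : Fin 1)).symm : Alt E 1 →L[ℝ] E →L[ℝ] ℝ) ∘L σ.curryLeft)) := rfl

theorem wedgeTwo_apply (σ : Alt E 2) (α : Alt E k) (v : Fin (k + 2) → E) :
    wedgeTwo σ α v = ∑ i : Fin (k + 1), ∑ j ≥ i,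
      (-1) ^ (i + j : ℕ) * (σ ![v i.castSucc, v j.succ] *
        α (j.removeNth (i.castSucc.removeNth v))) := by
  have h : ∀ x y, σ ![x, y] = - σ ![y, x] := by
    intro x y
    have h0 : σ (![y, x] ∘ Equiv.swap (0 : Fin 2) 1) = - σ ![y, x] :=
      σ.toAlternatingMap.map_swap ![y, x] (i := 0) (j := 1) (by decide)
    rw [← h0]; congr 1; ext i; fin_cases i <;> rfl
  have h1 : ∀ x y, (ofSubsingletonLIE (𝕜 := ℝ) (E := E) (F := ℝ) (0 : Fin 1)).symm (σ.curryLeft x) y = σ ![x, y] := by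
    intro x y
    exact (oneForm_apply (σ.curryLeft x) y)
  simp only [wedgeTwo, ContinuousAlternatingMap.smul_apply,
    alternatizeUncurryFin_alternatizeUncurryFinCLM_comp_apply, Finset.smul_sum]
  refine Finset.sum_congr rfl fun i _ => Finset.sum_congr rfl fun j _ => ?_
  have h2 : ∀ x y, ((ContinuousLinearMap.smulRightL ℝ E (Alt E k)).flip α ∘L
      ((ofSubsingletonLIE (𝕜 := ℝ) (E := E) (F := ℝ) (0 : Fin 1)).symm : Alt E 1 →L[ℝ] E →L[ℝ] ℝ)
        ∘L σ.curryLeft) x y = σ ![x, y] • α := by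
    intro x y
    rw [← h1]; rfl
  rw [h2, h2, h (v j.succ)]
  simp only [ContinuousAlternatingMap.smul_apply, smul_eq_mul, zsmul_eq_mul, Int.cast_pow,
    Int.cast_neg, Int.cast_one]
  ring

theorem swap_alt (B : E →L[ℝ] E →L[ℝ] Alt E k) :
    alternatizeUncurryFin (alternatizeUncurryFinCLM ℝ E ℝ ∘L B.flip) =
    - alternatizeUncurryFin (alternatizeUncurryFinCLM ℝ E ℝ ∘L B) := by
  have := alternatizeUncurryFin_alternatizeUncurryFinCLM_comp_of_symmetric
    (f := B.flip + B) (by intro x y; simp [add_comm])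
  rw [ContinuousLinearMap.comp_add, alternatizeUncurryFin_add] at this
  exact eq_neg_of_add_eq_zero_left this

theorem alt_smulRight_swap (θ : E →L[ℝ] ℝ) (A : E →L[ℝ] Alt E k) :
    alternatizeUncurryFin (alternatizeUncurryFinCLM ℝ E ℝ ∘L
      (ContinuousLinearMap.smulRightL ℝ E (Alt E k) θ ∘L A)) =
    - alternatizeUncurryFin (θ.smulRight (alternatizeUncurryFin A)) := by
  rw [eq_neg_iff_add_eq_zero, ← neg_eq_iff_add_eq_zero, ← swap_alt]
  congr 1
  ext x : 1
  simp only [ContinuousLinearMap.comp_apply, alternatizeUncurryFinCLM_apply,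
    ContinuousLinearMap.smulRight_apply]
  have : (ContinuousLinearMap.smulRightL ℝ E (Alt E k) θ ∘L A).flip x = θ x • A := by
    ext y : 1; simp
  rw [this, alternatizeUncurryFin_smul]

/-- If `W u = σ ∧ A u`, then the alternation of `W` is `σ ∧ (alternation of A)`. -/
theorem wedgeTwo_alt (σ : Alt E 2) (A : E →L[ℝ] Alt E k) (W : E →L[ℝ] Alt E (k + 2))
    (hW : ∀ u, W u = wedgeTwo σ (A u)) :
    alternatizeUncurryFin W = wedgeTwo σ (alternatizeUncurryFin A) := by
  set o : E →L[ℝ] E →L[ℝ] ℝ :=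
    ((ofSubsingletonLIE (𝕜 := ℝ) (E := E) (F := ℝ) (0 : Fin 1)).symm : Alt E 1 →L[ℝ] E →L[ℝ] ℝ) ∘L σ.curryLeft with ho
  let B : E →L[ℝ] E →L[ℝ] Alt E (k + 1) :=
    (ContinuousLinearMap.compL ℝ E (E →L[ℝ] Alt E k) (Alt E (k+1)) (alternatizeUncurryFinCLM ℝ E ℝ))
      ∘L ((ContinuousLinearMap.compL ℝ E (E →L[ℝ] ℝ) (E →L[ℝ] Alt E k)).flip o) ∘L
      (ContinuousLinearMap.smulRightL ℝ E (Alt E k)).flip ∘L A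
  have hW' : W = (2⁻¹ : ℝ) • (alternatizeUncurryFinCLM ℝ E ℝ ∘L B) := by
    ext u : 1
    rw [hW, wedgeTwo_eq]
    rfl
  rw [hW', alternatizeUncurryFin_smul, wedgeTwo_eq]
  congr 1
  rw [← neg_neg (alternatizeUncurryFin (_ ∘L B)), ← swap_alt, ← alternatizeUncurryFinCLM_apply,
    ← map_neg, alternatizeUncurryFinCLM_apply]
  congr 1
  ext v : 1
  have hB : B.flip v = alternatizeUncurryFinCLM ℝ E ℝ ∘L
      (ContinuousLinearMap.smulRightL ℝ E (Alt E k) (o v) ∘L A) := by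
    ext u : 1; rfl
  rw [_root_.neg_apply, ContinuousLinearMap.comp_apply, hB,
    alternatizeUncurryFinCLM_apply, alt_smulRight_swap, neg_neg]
  rfl

/-- Alternation in three arguments. -/
def alt3 (G : E →L[ℝ] E →L[ℝ] E →L[ℝ] Alt E k) : Alt E (k + 3) :=
  alternatizeUncurryFin (alternatizeUncurryFinCLM ℝ E ℝ ∘L
    (ContinuousLinearMap.compL ℝ E (E →L[ℝ] Alt E k) (Alt E (k+1)) (alternatizeUncurryFinCLM ℝ E ℝ)
      ∘L G))

theorem alt3_swap12 (G : E →L[ℝ] E →L[ℝ] E →L[ℝ] Alt E k) : alt3 G.flip = - alt3 G := by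
  rw [alt3, alt3, ← swap_alt]; rfl

def flip23 (G : E →L[ℝ] E →L[ℝ] E →L[ℝ] Alt E k) : E →L[ℝ] E →L[ℝ] E →L[ℝ] Alt E k :=
  ((ContinuousLinearMap.flipₗᵢ ℝ E E (Alt E k)) : _ →L[ℝ] (E →L[ℝ] E →L[ℝ] Alt E k)) ∘L G

theorem alt3_swap23 (G : E →L[ℝ] E →L[ℝ] E →L[ℝ] Alt E k) : alt3 (flip23 G) = - alt3 G := by
  rw [alt3, alt3, ← alternatizeUncurryFinCLM_apply, ← alternatizeUncurryFinCLM_apply, ← map_neg]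
  congr 1
  ext u : 1
  exact swap_alt (G u)

theorem alt3_add (G H : E →L[ℝ] E →L[ℝ] E →L[ℝ] Alt E k) : alt3 (G + H) = alt3 G + alt3 H := by
  simp only [alt3, ContinuousLinearMap.comp_add, alternatizeUncurryFin_add]

theorem wedgeTwo_alt_left (X : E →L[ℝ] Alt E 2) (α : Alt E k) (W : E →L[ℝ] Alt E (k + 2))
    (hW : ∀ u, W u = wedgeTwo (X u) α) (hX : alternatizeUncurryFin X = 0) :
    alternatizeUncurryFin W = 0 := by
  let G : E →L[ℝ] E →L[ℝ] E →L[ℝ] Alt E k :=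
    (ContinuousLinearMap.compL ℝ E (Alt E 1) (E →L[ℝ] Alt E k)
      ((ContinuousLinearMap.smulRightL ℝ E (Alt E k)).flip α ∘L
      ((ofSubsingletonLIE (𝕜 := ℝ) (E := E) (F := ℝ) (0 : Fin 1)).symm : Alt E 1 →L[ℝ] E →L[ℝ] ℝ))) ∘L
      ((curryLeftLI : Alt E 2 →ₗᵢ[ℝ] E →L[ℝ] Alt E 1).toContinuousLinearMap) ∘L X
  have hG : ∀ u v w, G u v w = X u ![v, w] • α := by
    intro u v w
    show ((ofSubsingletonLIE (𝕜 := ℝ) (E := E) (F := ℝ) (0 : Fin 1)).symm ((X u).curryLeft v)) w • α = _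
    congr 1
    exact oneForm_apply _ _
  have hWG : alternatizeUncurryFin W = (2⁻¹ : ℝ) • alt3 G := by
    rw [alt3, ← alternatizeUncurryFin_smul]
    congr 1
    ext u : 1
    rw [hW]; rfl
  have hsum : G + (flip23 G.flip + -G.flip) = 0 := by
    ext u v w : 3
    have h0 : ∑ i : Fin 3, (-1) ^ (i : ℕ) • X (![u, v, w] i) (i.removeNth ![u, v, w]) = 0 :=
      (alternatizeUncurryFin_apply X ![u, v, w]).symm.trans
        (congrArg (fun f : Alt E 3 => f ![u, v, w]) hX)
    have e0 : (0 : Fin 3).removeNth ![u, v, w] = ![v, w] := by ext i; fin_cases i <;> rfl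
    have e1 : (1 : Fin 3).removeNth ![u, v, w] = ![u, w] := by ext i; fin_cases i <;> rfl
    have e2 : (2 : Fin 3).removeNth ![u, v, w] = ![u, v] := by ext i; fin_cases i <;> rfl
    rw [Fin.sum_univ_three, e0, e1, e2] at h0
    have h : X u ![v, w] + (X w ![u, v] - X v ![u, w]) = 0 := by
      rw [← h0]; simp; ring
    have e : (G + (flip23 G.flip + -G.flip)) u v w = G u v w + (G w u v - G v u w) := by
      rw [sub_eq_add_neg]; rfl
    rw [e, hG, hG, hG, ← sub_smul, ← add_smul, h, zero_smul]
    rfl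
  have h3 := congrArg alt3 hsum
  have hz : alt3 (0 : E →L[ℝ] E →L[ℝ] E →L[ℝ] Alt E k) = 0 := by
    have := alt3_add (0 : E →L[ℝ] E →L[ℝ] E →L[ℝ] Alt E k) 0
    rw [show (0 : E →L[ℝ] E →L[ℝ] E →L[ℝ] Alt E k) + 0 = 0 from by ext u v w : 3; simp] at this
    exact left_eq_add.1 this
  have hn : alt3 (-G.flip) = alt3 G := by
    have := alt3_add (G.flip) (-G.flip)
    rw [show G.flip + -G.flip = 0 from by ext u v w : 3; exact add_neg_cancel _, hz, alt3_swap12] at this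
    exact (neg_add_eq_zero.1 this.symm).symm
  rw [alt3_add, alt3_add, hn, alt3_swap23, alt3_swap12, neg_neg, hz] at h3
  rw [hWG]
  have h4 : (3 : ℝ) • alt3 G = 0 := by rw [← h3]; module
  rw [(smul_eq_zero.1 h4).resolve_left (by norm_num), smul_zero]

/-- `wedgeOne` as a continuous bilinear map. -/
def wedgeOneL (k : ℕ) : Alt E 1 →L[ℝ] Alt E k →L[ℝ] Alt E (k + 1) :=
  ContinuousLinearMap.compL ℝ (Alt E k) (E →L[ℝ] Alt E k) (Alt E (k + 1))
      (alternatizeUncurryFinCLM ℝ E ℝ) ∘L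
    ContinuousLinearMap.smulRightL ℝ E (Alt E k) ∘L
      ((ofSubsingletonLIE (𝕜 := ℝ) (E := E) (F := ℝ) (0 : Fin 1)).symm : Alt E 1 →L[ℝ] E →L[ℝ] ℝ)

theorem wedgeOneL_apply (θ : Alt E 1) (α : Alt E k) : wedgeOneL k θ α = wedgeOne θ α := rfl

/-- `wedgeTwo` as a continuous bilinear map (arguments in the order `α`, `σ`). -/
def wedgeTwoL (k : ℕ) : Alt E k →L[ℝ] Alt E 2 →L[ℝ] Alt E (k + 2) :=
  (ContinuousLinearMap.compL ℝ (Alt E 2) (E →L[ℝ] E →L[ℝ] Alt E k) (Alt E (k + 2))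
      ((2⁻¹ : ℝ) • (alternatizeUncurryFinCLM ℝ E ℝ ∘L
        ContinuousLinearMap.compL ℝ E (E →L[ℝ] Alt E k) (Alt E (k + 1))
          (alternatizeUncurryFinCLM ℝ E ℝ)))) ∘L
    ((ContinuousLinearMap.compL ℝ (Alt E 2) (E →L[ℝ] Alt E 1) (E →L[ℝ] E →L[ℝ] Alt E k)).flip
      (curryLeftLI : Alt E 2 →ₗᵢ[ℝ] E →L[ℝ] Alt E 1).toContinuousLinearMap) ∘L
    (ContinuousLinearMap.compL ℝ E (Alt E 1) (E →L[ℝ] Alt E k)) ∘L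
    ((ContinuousLinearMap.compL ℝ (Alt E 1) (E →L[ℝ] ℝ) (E →L[ℝ] Alt E k)).flip
      ((ofSubsingletonLIE (𝕜 := ℝ) (E := E) (F := ℝ) (0 : Fin 1)).symm :
        Alt E 1 →L[ℝ] E →L[ℝ] ℝ)) ∘L
    (ContinuousLinearMap.smulRightL ℝ E (Alt E k)).flip

theorem wedgeTwoL_apply (σ : Alt E 2) (α : Alt E k) : wedgeTwoL k α σ = wedgeTwo σ α := rfl

theorem wedgeOne_comp (θ : Alt E 1) (α : Alt E k) (g : E →L[ℝ] E) :
    wedgeOne (θ.compContinuousLinearMap g) (α.compContinuousLinearMap g) =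
      (wedgeOne θ α).compContinuousLinearMap g := by
  ext v
  simp only [wedgeOne_apply, compContinuousLinearMap_apply]
  refine Finset.sum_congr rfl fun i _ => ?_
  congr 3
  ext j; fin_cases j; rfl

theorem wedgeTwo_comp (σ : Alt E 2) (α : Alt E k) (g : E →L[ℝ] E) :
    wedgeTwo (σ.compContinuousLinearMap g) (α.compContinuousLinearMap g) =
      (wedgeTwo σ α).compContinuousLinearMap g := by
  ext v
  simp only [wedgeTwo_apply, compContinuousLinearMap_apply]
  refine Finset.sum_congr rfl fun i _ => Finset.sum_congr rfl fun j _ => ?_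
  congr 3
  ext l; fin_cases l <;> rfl

theorem contDiff_compCLM (k : ℕ) : ContDiff ℝ ∞ (fun g : E →L[ℝ] E =>
    (compContinuousLinearMapCLM g : Alt E k →L[ℝ] Alt E k)) := by
  induction k with
  | zero =>
    have : (fun g : E →L[ℝ] E => (compContinuousLinearMapCLM g : Alt E 0 →L[ℝ] Alt E 0)) =
        fun _ => ContinuousLinearMap.id ℝ _ := by
      ext g f v
      simp only [compContinuousLinearMapCLM_apply, compContinuousLinearMap_apply,
        ContinuousLinearMap.id_apply]
      congr 1; ext i; exact i.elim0
    rw [this]; exact contDiff_const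
  | succ k ih =>
    have : (fun g : E →L[ℝ] E => (compContinuousLinearMapCLM g : Alt E (k+1) →L[ℝ] Alt E (k+1))) =
        fun g => ((k + 1 : ℝ)⁻¹ • alternatizeUncurryFinCLM ℝ E ℝ) ∘L
          ((ContinuousLinearMap.compL ℝ E (Alt E k) (Alt E k) (compContinuousLinearMapCLM g)) ∘L
          ((ContinuousLinearMap.compL ℝ E E (Alt E k)).flip g) ∘L
          (curryLeftLI : Alt E (k+1) →ₗᵢ[ℝ] E →L[ℝ] Alt E k).toContinuousLinearMap) := by
      ext g f : 2
      have h : (((ContinuousLinearMap.compL ℝ E (Alt E k) (Alt E k) (compContinuousLinearMapCLM g)) ∘L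
          ((ContinuousLinearMap.compL ℝ E E (Alt E k)).flip g) ∘L
          (curryLeftLI : Alt E (k+1) →ₗᵢ[ℝ] E →L[ℝ] Alt E k).toContinuousLinearMap)) f =
          (f.compContinuousLinearMap g).curryLeft := by
        ext x : 1
        rw [curryLeft_compContinuousLinearMap]; rfl
      rw [ContinuousLinearMap.comp_apply, h]
      show _ = (k + 1 : ℝ)⁻¹ • alternatizeUncurryFin _
      rw [alternatizeUncurryFin_curryLeft, compContinuousLinearMapCLM_apply,
        ← Nat.cast_smul_eq_nsmul ℝ, smul_smul]
      push_cast
      rw [inv_mul_cancel₀ (by positivity), one_smul]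
    rw [this]
    refine contDiff_const.clm_comp (ContDiff.clm_comp ?_ (ContDiff.clm_comp ?_ contDiff_const))
    · exact (ContinuousLinearMap.contDiff _).comp ih
    · exact ContinuousLinearMap.contDiff _
end

section
variable {E : Type*} [NormedAddCommGroup E] [NormedSpace ℝ E]
  {M : Type*} [TopologicalSpace M] [ChartedSpace E M] {k : ℕ}

/-- Families of alternating `k`-forms on the tangent spaces, with no smoothness condition. -/
abbrev RawForm (E M : Type*) [NormedAddCommGroup E] [NormedSpace ℝ E] [TopologicalSpace M]
    [ChartedSpace E M] (k : ℕ) : Type _ :=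
  ∀ x : M, TangentSpace 𝓘(ℝ, E) x [⋀^Fin k]→L[ℝ] Bundle.Trivial M ℝ x

/-- The local expression of a form in the chart at `x₀`: its pullback under the inverse chart. -/
def inChart (s : RawForm E M k) (x₀ : M) (y : E) : E [⋀^Fin k]→L[ℝ] ℝ :=
  (s ((extChartAt 𝓘(ℝ, E) x₀).symm y)).compContinuousLinearMap
    (mfderiv 𝓘(ℝ, E) 𝓘(ℝ, E) (extChartAt 𝓘(ℝ, E) x₀).symm y)

theorem transition_eventually (x₀ x₁ : M) (y : E)
    (hy : y ∈ (extChartAt 𝓘(ℝ, E) x₀).target)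
    (hy' : (extChartAt 𝓘(ℝ, E) x₀).symm y ∈ (extChartAt 𝓘(ℝ, E) x₁).source) :
    ∀ᶠ z in 𝓝 y, z ∈ (extChartAt 𝓘(ℝ, E) x₀).target ∧
      (extChartAt 𝓘(ℝ, E) x₀).symm z ∈ (extChartAt 𝓘(ℝ, E) x₁).source := by
  have h1 := (isOpen_extChartAt_target (I := 𝓘(ℝ, E)) x₀).mem_nhds hy
  have h2 : ContinuousAt (extChartAt 𝓘(ℝ, E) x₀).symm y := continuousAt_extChartAt_symm'' hy
  exact Filter.Eventually.and h1
    (h2.eventually ((isOpen_extChartAt_source (I := 𝓘(ℝ, E)) x₁).mem_nhds hy'))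

variable [IsManifold 𝓘(ℝ, E) ∞ M]

/-- Smooth differential `k`-forms on `M`: the `C^∞` sections of the bundle of alternating
`k`-forms on the tangent spaces. -/
def DiffForm (E M : Type*) [NormedAddCommGroup E] [NormedSpace ℝ E] [TopologicalSpace M]
    [ChartedSpace E M] [IsManifold 𝓘(ℝ, E) ∞ M] (k : ℕ) : Type _ :=
  ContMDiffSection 𝓘(ℝ, E) (E [⋀^Fin k]→L[ℝ] ℝ) ∞
    (fun x : M => TangentSpace 𝓘(ℝ, E) x [⋀^Fin k]→L[ℝ] Bundle.Trivial M ℝ x)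

namespace DiffForm

instance : DFunLike (DiffForm E M k) M
    (fun x => TangentSpace 𝓘(ℝ, E) x [⋀^Fin k]→L[ℝ] Bundle.Trivial M ℝ x) :=
  inferInstanceAs (DFunLike (ContMDiffSection _ _ _ _) _ _)

instance : AddCommGroup (DiffForm E M k) :=
  inferInstanceAs (AddCommGroup (ContMDiffSection 𝓘(ℝ, E) (E [⋀^Fin k]→L[ℝ] ℝ) ∞
    (fun x : M => TangentSpace 𝓘(ℝ, E) x [⋀^Fin k]→L[ℝ] Bundle.Trivial M ℝ x)))

instance : Module ℝ (DiffForm E M k) :=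
  inferInstanceAs (Module ℝ (ContMDiffSection 𝓘(ℝ, E) (E [⋀^Fin k]→L[ℝ] ℝ) ∞
    (fun x : M => TangentSpace 𝓘(ℝ, E) x [⋀^Fin k]→L[ℝ] Bundle.Trivial M ℝ x)))

theorem ext {α β : DiffForm E M k} (h : ∀ x, α x = β x) : α = β := DFunLike.ext _ _ h

theorem coe_add (α β : DiffForm E M k) : ⇑(α + β) = ⇑α + ⇑β := rfl

theorem coe_neg (α : DiffForm E M k) : ⇑(-α) = -⇑α := rfl

theorem coe_smul (c : ℝ) (α : DiffForm E M k) : ⇑(c • α) = c • ⇑α := rfl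

end DiffForm

theorem triv_eq_inChart (s : RawForm E M k) (x₀ x : M)
    (hx : x ∈ (extChartAt 𝓘(ℝ, E) x₀).source) :
    (trivializationAt (E [⋀^Fin k]→L[ℝ] ℝ)
      (fun x : M => TangentSpace 𝓘(ℝ, E) x [⋀^Fin k]→L[ℝ] Bundle.Trivial M ℝ x) x₀ ⟨x, s x⟩).2
      = inChart s x₀ (extChartAt 𝓘(ℝ, E) x₀ x) := by
  have h2 := (extChartAt 𝓘(ℝ, E) x₀).left_inv hx
  have hx' : x ∈ (chartAt E x₀).source := by simpa using hx
  have h := TangentBundle.symmL_trivializationAt (I := 𝓘(ℝ, E)) hx'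
  rw [FiberBundle.trivializationAt_continuousAlternatingMap_apply]
  ext v
  simp only [ContinuousAlternatingMap.inCoordinates, inChart]
  rw [h]
  simp only [modelWithCornersSelf_coe, Set.range_id, mfderivWithin_univ]
  have key : ∀ z, z = x → ∀ (A : E →L[ℝ] E) (v : Fin k → E),
      (ContinuousAlternatingMap.compContinuousLinearMap (s x) A : E [⋀^Fin k]→L[ℝ] ℝ) v
      = (ContinuousAlternatingMap.compContinuousLinearMap (s z) A : E [⋀^Fin k]→L[ℝ] ℝ) v := by
    rintro z rfl A v; rfl
  refine Eq.trans ?_ (key _ h2 _ v)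
  have ht : ∀ w : ℝ, Bundle.Trivialization.continuousLinearMapAt ℝ
      (trivializationAt ℝ (Bundle.Trivial M ℝ) x₀) x w = w := by
    intro w; simp
  exact ht _

theorem fderiv_transition (x₀ x₁ : M) (y : E)
    (hy : y ∈ (extChartAt 𝓘(ℝ, E) x₀).target)
    (hy' : (extChartAt 𝓘(ℝ, E) x₀).symm y ∈ (extChartAt 𝓘(ℝ, E) x₁).source) :
    fderiv ℝ (extChartAt 𝓘(ℝ, E) x₁ ∘ (extChartAt 𝓘(ℝ, E) x₀).symm) y =
      (mfderiv 𝓘(ℝ, E) 𝓘(ℝ, E) (extChartAt 𝓘(ℝ, E) x₁) ((extChartAt 𝓘(ℝ, E) x₀).symm y)).comp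
        (mfderiv 𝓘(ℝ, E) 𝓘(ℝ, E) (extChartAt 𝓘(ℝ, E) x₀).symm y) := by
  have hI : IsManifold 𝓘(ℝ, E) 1 M := IsManifold.of_le (n := ∞) (by norm_num)
  have h0 : MDifferentiableAt 𝓘(ℝ, E) 𝓘(ℝ, E) (extChartAt 𝓘(ℝ, E) x₀).symm y := by
    have := mdifferentiableWithinAt_extChartAt_symm (I := 𝓘(ℝ, E)) hy
    simpa only [modelWithCornersSelf_coe, Set.range_id, mdifferentiableWithinAt_univ] using this
  have h1 : MDifferentiableAt 𝓘(ℝ, E) 𝓘(ℝ, E) (extChartAt 𝓘(ℝ, E) x₁)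
      ((extChartAt 𝓘(ℝ, E) x₀).symm y) := mdifferentiableAt_extChartAt (by simpa using hy')
  rw [← mfderiv_eq_fderiv]
  exact mfderiv_comp y h1 h0

/-- Change of charts. -/
theorem inChart_transition (s : RawForm E M k) (x₀ x₁ : M) (y : E)
    (hy : y ∈ (extChartAt 𝓘(ℝ, E) x₀).target)
    (hy' : (extChartAt 𝓘(ℝ, E) x₀).symm y ∈ (extChartAt 𝓘(ℝ, E) x₁).source) :
    inChart s x₀ y =
      (inChart s x₁ ((extChartAt 𝓘(ℝ, E) x₁ ∘ (extChartAt 𝓘(ℝ, E) x₀).symm) y)).compContinuousLinearMap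
        (fderiv ℝ (extChartAt 𝓘(ℝ, E) x₁ ∘ (extChartAt 𝓘(ℝ, E) x₀).symm) y) := by
  have hI : IsManifold 𝓘(ℝ, E) 1 M := IsManifold.of_le (n := ∞) (by norm_num)
  have e1 := fderiv_transition x₀ x₁ y hy hy'
  have h3 := mfderivWithin_extChartAt_symm_comp_mfderiv_extChartAt' (I := 𝓘(ℝ, E)) hy'
  simp only [modelWithCornersSelf_coe, Set.range_id, mfderivWithin_univ] at h3
  rw [e1]
  have h4 := (extChartAt 𝓘(ℝ, E) x₁).left_inv hy'
  simp only [inChart, Function.comp_apply]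
  have key : ∀ (z w : M), z = w → ∀ (A B : E →L[ℝ] E), A = B →
      (ContinuousAlternatingMap.compContinuousLinearMap (s w) A : E [⋀^Fin k]→L[ℝ] ℝ)
      = (ContinuousAlternatingMap.compContinuousLinearMap (s z) B : E [⋀^Fin k]→L[ℝ] ℝ) := by
    rintro z _ rfl A _ rfl; rfl
  refine (key _ _ h4 _ ((mfderiv 𝓘(ℝ, E) 𝓘(ℝ, E) (extChartAt 𝓘(ℝ, E) x₁).symm
    (extChartAt 𝓘(ℝ, E) x₁ ((extChartAt 𝓘(ℝ, E) x₀).symm y))).comp (((mfderiv 𝓘(ℝ, E) 𝓘(ℝ, E) (extChartAt 𝓘(ℝ, E) x₁) ((extChartAt 𝓘(ℝ, E) x₀).symm y)).comp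
        (mfderiv 𝓘(ℝ, E) 𝓘(ℝ, E) (extChartAt 𝓘(ℝ, E) x₀).symm y)))) ?_).trans rfl
  have := congrArg (fun A : E →L[ℝ] E => A.comp (mfderiv 𝓘(ℝ, E) 𝓘(ℝ, E) (extChartAt 𝓘(ℝ, E) x₀).symm y : E →L[ℝ] E)) h3
  exact this.symm

theorem contDiffAt_transition (x₀ x₁ : M) (y : E)
    (hy : y ∈ (extChartAt 𝓘(ℝ, E) x₀).target)
    (hy' : (extChartAt 𝓘(ℝ, E) x₀).symm y ∈ (extChartAt 𝓘(ℝ, E) x₁).source) :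
    ContDiffAt ℝ ∞ (extChartAt 𝓘(ℝ, E) x₁ ∘ (extChartAt 𝓘(ℝ, E) x₀).symm) y := by
  rw [← contMDiffAt_iff_contDiffAt]
  have h1 : ContMDiffAt 𝓘(ℝ, E) 𝓘(ℝ, E) ∞ (extChartAt 𝓘(ℝ, E) x₁)
    ((extChartAt 𝓘(ℝ, E) x₀).symm y) := contMDiffAt_extChartAt' (by simpa using hy')
  have h0 : ContMDiffAt 𝓘(ℝ, E) 𝓘(ℝ, E) ∞ (extChartAt 𝓘(ℝ, E) x₀).symm y :=
    (contMDiffOn_extChartAt_symm x₀).contMDiffAt ((isOpen_extChartAt_target x₀).mem_nhds hy)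
  exact h1.comp y h0

theorem contMDiffAt_section_iff_inChart (s : RawForm E M k) (x₀ : M) :
    ContMDiffAt 𝓘(ℝ, E) (𝓘(ℝ, E).prod 𝓘(ℝ, E [⋀^Fin k]→L[ℝ] ℝ)) ∞
      (fun x => Bundle.TotalSpace.mk' (E [⋀^Fin k]→L[ℝ] ℝ)
        (E := fun x : M => TangentSpace 𝓘(ℝ, E) x [⋀^Fin k]→L[ℝ] Bundle.Trivial M ℝ x) x (s x)) x₀
      ↔ ContDiffAt ℝ ∞ (inChart s x₀) (extChartAt 𝓘(ℝ, E) x₀ x₀) := by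
  rw [Bundle.contMDiffAt_section, ← contMDiffAt_iff_contDiffAt]
  have hx0 := mem_extChartAt_source (I := 𝓘(ℝ, E)) x₀
  have hev : ∀ᶠ x in 𝓝 x₀, x ∈ (extChartAt 𝓘(ℝ, E) x₀).source :=
    (isOpen_extChartAt_source x₀).mem_nhds hx0
  constructor
  · intro h
    have h0 : ContMDiffAt 𝓘(ℝ, E) 𝓘(ℝ, E) ∞ (extChartAt 𝓘(ℝ, E) x₀).symm
        (extChartAt 𝓘(ℝ, E) x₀ x₀) :=
      (contMDiffOn_extChartAt_symm x₀).contMDiffAt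
        ((isOpen_extChartAt_target x₀).mem_nhds (mem_extChartAt_target x₀))
    have h' := ContMDiffAt.comp_of_eq (f := (extChartAt 𝓘(ℝ, E) x₀).symm)
      h h0 (extChartAt_to_inv x₀)
    refine h'.congr_of_eventuallyEq ?_
    filter_upwards [(isOpen_extChartAt_target (I := 𝓘(ℝ, E)) x₀).mem_nhds (mem_extChartAt_target x₀)]
      with y hy
    rw [Function.comp_apply, triv_eq_inChart s x₀ _ ((extChartAt 𝓘(ℝ, E) x₀).map_target hy),
      (extChartAt 𝓘(ℝ, E) x₀).right_inv hy]
  · intro h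
    have h' := h.comp x₀ (contMDiffAt_extChartAt (I := 𝓘(ℝ, E)))
    refine h'.congr_of_eventuallyEq ?_
    filter_upwards [hev] with x hx
    rw [triv_eq_inChart s x₀ x hx]; rfl

theorem DiffForm.contDiffAt_inChart (α : DiffForm E M k) (x₀ : M) {y : E}
    (hy : y ∈ (extChartAt 𝓘(ℝ, E) x₀).target) : ContDiffAt ℝ ∞ (inChart α x₀) y := by
  set x₁ := (extChartAt 𝓘(ℝ, E) x₀).symm y with hx₁
  have hy' : (extChartAt 𝓘(ℝ, E) x₀).symm y ∈ (extChartAt 𝓘(ℝ, E) x₁).source :=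
    mem_extChartAt_source x₁
  have h1 := (contMDiffAt_section_iff_inChart (α : RawForm E M k) x₁).1 (ContMDiffSection.contMDiff α x₁)
  have hτ := contDiffAt_transition x₀ x₁ y hy hy'
  have h2 : ContDiffAt ℝ ∞ (fun z => (inChart α x₁ ((extChartAt 𝓘(ℝ, E) x₁ ∘
      (extChartAt 𝓘(ℝ, E) x₀).symm) z)).compContinuousLinearMap
        (fderiv ℝ (extChartAt 𝓘(ℝ, E) x₁ ∘ (extChartAt 𝓘(ℝ, E) x₀).symm) z)) y := by
    have h1' : ContDiffAt ℝ ∞ (inChart α x₁) ((extChartAt 𝓘(ℝ, E) x₁ ∘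
      (extChartAt 𝓘(ℝ, E) x₀).symm) y) := h1
    have h3 : ContDiffAt ℝ ∞ (fun z => inChart α x₁ ((extChartAt 𝓘(ℝ, E) x₁ ∘
      (extChartAt 𝓘(ℝ, E) x₀).symm) z)) y := h1'.comp y hτ
    have h4 : ContDiffAt ℝ ∞ (fderiv ℝ (extChartAt 𝓘(ℝ, E) x₁ ∘
      (extChartAt 𝓘(ℝ, E) x₀).symm)) y := hτ.fderiv_right (by norm_num)
    exact ((contDiff_compCLM (E := E) k).contDiffAt.comp y h4).clm_apply h3
  refine h2.congr_of_eventuallyEq ?_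
  filter_upwards [transition_eventually x₀ x₁ y hy hy'] with z hz
  exact inChart_transition _ x₀ x₁ z hz.1 hz.2

end
section
variable {E : Type*} [NormedAddCommGroup E] [NormedSpace ℝ E]
  {M : Type*} [TopologicalSpace M] [ChartedSpace E M] {k : ℕ}

theorem inChart_add (s t : RawForm E M k) (x₀ : M) :
    inChart (s + t) x₀ = inChart s x₀ + inChart t x₀ := rfl

theorem inChart_smul (c : ℝ) (s : RawForm E M k) (x₀ : M) :
    inChart (c • s) x₀ = c • inChart s x₀ := rfl

/-- Pointwise wedge product with a `1`-form. -/
def wedgeOneRaw (θ : RawForm E M 1) (s : RawForm E M k) : RawForm E M (k + 1) :=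
  fun x => wedgeOne (E := E) (θ x) (s x)

/-- Pointwise wedge product with a `2`-form. -/
def wedgeTwoRaw (σ : RawForm E M 2) (s : RawForm E M k) : RawForm E M (k + 2) :=
  fun x => wedgeTwo (E := E) (σ x) (s x)

theorem inChart_wedgeOneRaw (θ : RawForm E M 1) (s : RawForm E M k) (x₀ : M) (y : E) :
    inChart (wedgeOneRaw θ s) x₀ y = wedgeOne (inChart θ x₀ y) (inChart s x₀ y) :=
  (wedgeOne_comp (E := E) (θ _) (s _) _).symm

theorem inChart_wedgeTwoRaw (σ : RawForm E M 2) (s : RawForm E M k) (x₀ : M) (y : E) :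
    inChart (wedgeTwoRaw σ s) x₀ y = wedgeTwo (inChart σ x₀ y) (inChart s x₀ y) :=
  (wedgeTwo_comp (E := E) (σ _) (s _) _).symm

/-- The exterior derivative: at `x` it is the exterior derivative of the local expression in the
chart at `x`, pulled back to the tangent space at `x`. By `inChart_extD` any chart may be used. -/
def extDRaw (s : RawForm E M k) : RawForm E M (k + 1) := fun x =>
  (extDeriv (inChart s x) (extChartAt 𝓘(ℝ, E) x x)).compContinuousLinearMap
    (mfderiv 𝓘(ℝ, E) 𝓘(ℝ, E) (extChartAt 𝓘(ℝ, E) x) x)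

variable [IsManifold 𝓘(ℝ, E) ∞ M]

theorem rawForm_ext {s t : RawForm E M k}
    (h : ∀ x, inChart s x (extChartAt 𝓘(ℝ, E) x x) = inChart t x (extChartAt 𝓘(ℝ, E) x x)) :
    s = t := by
  funext x
  have hI : IsManifold 𝓘(ℝ, E) 1 M := IsManifold.of_le (n := ∞) (by norm_num)
  have hx := mem_extChartAt_source (I := 𝓘(ℝ, E)) x
  have h3 := mfderivWithin_extChartAt_symm_comp_mfderiv_extChartAt' (I := 𝓘(ℝ, E)) hx
  simp only [modelWithCornersSelf_coe, Set.range_id, mfderivWithin_univ] at h3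
  have key : ∀ r : RawForm E M k, (inChart r x (extChartAt 𝓘(ℝ, E) x x)).compContinuousLinearMap
      (mfderiv 𝓘(ℝ, E) 𝓘(ℝ, E) (extChartAt 𝓘(ℝ, E) x) x) = r x := by
    intro r
    have h4 := (extChartAt 𝓘(ℝ, E) x).left_inv hx
    have k2 : ∀ z w : M, z = w → ∀ A : E →L[ℝ] E, A = ContinuousLinearMap.id ℝ E →
        (ContinuousAlternatingMap.compContinuousLinearMap (r z) A : E [⋀^Fin k]→L[ℝ] ℝ) = r w := by
      rintro z _ rfl A rfl; rfl
    refine Eq.trans ?_ (k2 _ _ h4 _ h3)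
    rfl
  rw [← key s, h, key]

theorem inChart_extDRaw (α : DiffForm E M k) (x₀ : M) {y : E}
    (hy : y ∈ (extChartAt 𝓘(ℝ, E) x₀).target) :
    inChart (extDRaw (α : RawForm E M k)) x₀ y = extDeriv (inChart α x₀) y := by
  set x₁ := (extChartAt 𝓘(ℝ, E) x₀).symm y with hx₁
  have hy' : (extChartAt 𝓘(ℝ, E) x₀).symm y ∈ (extChartAt 𝓘(ℝ, E) x₁).source :=
    mem_extChartAt_source x₁
  have hτ := contDiffAt_transition x₀ x₁ y hy hy'
  have h1 : DifferentiableAt ℝ (inChart α x₁) ((extChartAt 𝓘(ℝ, E) x₁ ∘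
      (extChartAt 𝓘(ℝ, E) x₀).symm) y) :=
    (α.contDiffAt_inChart x₁ (mem_extChartAt_target x₁)).differentiableAt (by norm_num)
  have h2 : inChart α x₀ =ᶠ[𝓝 y] fun z => (inChart α x₁ ((extChartAt 𝓘(ℝ, E) x₁ ∘
      (extChartAt 𝓘(ℝ, E) x₀).symm) z)).compContinuousLinearMap
        (fderiv ℝ (extChartAt 𝓘(ℝ, E) x₁ ∘ (extChartAt 𝓘(ℝ, E) x₀).symm) z) := by
    filter_upwards [transition_eventually x₀ x₁ y hy hy'] with z hz
    exact inChart_transition _ x₀ x₁ z hz.1 hz.2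
  have hr : minSmoothness ℝ 2 ≤ (∞ : WithTop ℕ∞) := by
    rw [minSmoothness_of_isRCLikeNormedField]; exact ENat.LEInfty.out
  rw [h2.extDeriv_eq, extDeriv_pullback h1 hτ hr,
    fderiv_transition x₀ x₁ y hy hy']
  rfl

/-- A differential form from a family whose local expressions are smooth. -/
def DiffForm.mkOf (s : RawForm E M k)
    (h : ∀ x₀, ContDiffAt ℝ ∞ (inChart s x₀) (extChartAt 𝓘(ℝ, E) x₀ x₀)) : DiffForm E M k :=
  ContMDiffSection.mk s fun x => (contMDiffAt_section_iff_inChart s x).2 (h x)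

theorem contDiffAt_inChart_extDRaw (α : DiffForm E M k) (x₀ : M) :
    ContDiffAt ℝ ∞ (inChart (extDRaw (α : RawForm E M k)) x₀) (extChartAt 𝓘(ℝ, E) x₀ x₀) := by
  have h : ContDiffAt ℝ ∞ (extDeriv (inChart α x₀)) (extChartAt 𝓘(ℝ, E) x₀ x₀) :=
    (alternatizeUncurryFinCLM ℝ E ℝ).contDiff.contDiffAt.comp _
      ((α.contDiffAt_inChart x₀ (mem_extChartAt_target x₀)).fderiv_right (by norm_num))
  refine h.congr_of_eventuallyEq ?_
  filter_upwards [(isOpen_extChartAt_target (I := 𝓘(ℝ, E)) x₀).mem_nhds (mem_extChartAt_target x₀)]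
    with y hy using inChart_extDRaw α x₀ hy

theorem DiffForm.ext_inChart {α β : DiffForm E M k}
    (h : ∀ x, inChart α x (extChartAt 𝓘(ℝ, E) x x) = inChart β x (extChartAt 𝓘(ℝ, E) x x)) :
    α = β := DFunLike.coe_injective (rawForm_ext h)

/-- The exterior derivative `d : Ω^k(M) → Ω^{k+1}(M)`. -/
def extD (k : ℕ) : DiffForm E M k →ₗ[ℝ] DiffForm E M (k + 1) where
  toFun α := DiffForm.mkOf (extDRaw (α : RawForm E M k)) (contDiffAt_inChart_extDRaw α)
  map_add' α β := by
    refine DiffForm.ext_inChart fun x => ?_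
    have hx := mem_extChartAt_target (I := 𝓘(ℝ, E)) x
    refine (inChart_extDRaw (α + β) x hx).trans ?_
    refine Eq.trans ?_ (congrArg₂ (· + ·) (inChart_extDRaw α x hx) (inChart_extDRaw β x hx)).symm
    exact extDeriv_add ((α.contDiffAt_inChart x hx).differentiableAt (by norm_num))
      ((β.contDiffAt_inChart x hx).differentiableAt (by norm_num))
  map_smul' c α := by
    refine DiffForm.ext_inChart fun x => ?_
    have hx := mem_extChartAt_target (I := 𝓘(ℝ, E)) x
    refine (inChart_extDRaw (c • α) x hx).trans ?_
    refine Eq.trans ?_ (congrArg (c • ·) (inChart_extDRaw α x hx)).symm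
    exact extDeriv_smul c (inChart α x)

/-- In every chart, `d` is the exterior derivative of the local expression. -/
theorem inChart_extD (α : DiffForm E M k) (x₀ : M) {y : E}
    (hy : y ∈ (extChartAt 𝓘(ℝ, E) x₀).target) :
    inChart (extD k α) x₀ y = extDeriv (inChart α x₀) y := inChart_extDRaw α x₀ hy

/-- `α ↦ θ ∧ α` for a `1`-form `θ`. -/
def DiffForm.wedge1 (θ : DiffForm E M 1) (k : ℕ) : DiffForm E M k →ₗ[ℝ] DiffForm E M (k + 1) where
  toFun α := DiffForm.mkOf (wedgeOneRaw (θ : RawForm E M 1) (α : RawForm E M k)) fun x₀ => by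
    have hx := mem_extChartAt_target (I := 𝓘(ℝ, E)) x₀
    have h := (((wedgeOneL (E := E) k).contDiff.contDiffAt).comp _
      (θ.contDiffAt_inChart x₀ hx)).clm_apply (α.contDiffAt_inChart x₀ hx)
    exact h.congr_of_eventuallyEq (.of_forall fun y => inChart_wedgeOneRaw _ _ x₀ y)
  map_add' α β := DiffForm.ext fun x => map_add (wedgeOneL (E := E) k (θ x)) (α x) (β x)
  map_smul' c α := DiffForm.ext fun x => map_smul (wedgeOneL (E := E) k (θ x)) c (α x)

/-- `α ↦ σ ∧ α` for a `2`-form `σ`. -/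
def DiffForm.wedge2 (σ : DiffForm E M 2) (k : ℕ) : DiffForm E M k →ₗ[ℝ] DiffForm E M (k + 2) where
  toFun α := DiffForm.mkOf (wedgeTwoRaw (σ : RawForm E M 2) (α : RawForm E M k)) fun x₀ => by
    have hx := mem_extChartAt_target (I := 𝓘(ℝ, E)) x₀
    have h := (((wedgeTwoL (E := E) k).contDiff.contDiffAt).comp _
      (α.contDiffAt_inChart x₀ hx)).clm_apply (σ.contDiffAt_inChart x₀ hx)
    exact h.congr_of_eventuallyEq (.of_forall fun y => inChart_wedgeTwoRaw _ _ x₀ y)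
  map_add' α β := DiffForm.ext fun x =>
    congrArg (fun f => f (σ x)) (map_add (wedgeTwoL (E := E) k) (α x) (β x))
  map_smul' c α := DiffForm.ext fun x =>
    congrArg (fun f => f (σ x)) (map_smul (wedgeTwoL (E := E) k) c (α x))

theorem inChart_wedge1 (θ : DiffForm E M 1) (α : DiffForm E M k) (x₀ : M) (y : E) :
    inChart (θ.wedge1 k α) x₀ y = wedgeOne (inChart θ x₀ y) (inChart α x₀ y) :=
  inChart_wedgeOneRaw _ _ _ _

theorem inChart_wedge2 (σ : DiffForm E M 2) (α : DiffForm E M k) (x₀ : M) (y : E) :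
    inChart (σ.wedge2 k α) x₀ y = wedgeTwo (inChart σ x₀ y) (inChart α x₀ y) :=
  inChart_wedgeTwoRaw _ _ _ _
end
section
variable {E : Type*} [NormedAddCommGroup E] [NormedSpace ℝ E]
  {M : Type*} [TopologicalSpace M] [ChartedSpace E M] {k : ℕ}

theorem wedgeTwo_wedgeOne (σ : Alt E 2) (θ : Alt E 1) :
    (wedgeTwo σ θ : Alt E 3) = wedgeOne θ σ := by
  refine ContinuousAlternatingMap.ext fun v => ?_
  refine (wedgeTwo_apply σ θ v).trans (Eq.trans ?_ (wedgeOne_apply θ σ v).symm)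
  have hs : ∀ a b c d e f : ℝ, a = f → b = e → c = d → a + b + c = d + e + f := by
    intros; subst_vars; ring
  have h1 : ∀ w w' : Fin 1 → E, w 0 = w' 0 → θ w = θ w' := by
    intro w w' h; congr 1; ext i; fin_cases i; exact h
  have h2 : ∀ w w' : Fin 2 → E, w 0 = w' 0 → w 1 = w' 1 → σ w = σ w' := by
    intro w w' h h'; congr 1; ext i; fin_cases i; exacts [h, h']
  rw [Fin.sum_univ_three, Fin.sum_univ_two]
  rw [show Finset.Ici (0 : Fin (1 + 1)) = {0, 1} by decide,
    show Finset.Ici (1 : Fin (1 + 1)) = {1} by decide,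
    Finset.sum_pair (by decide), Finset.sum_singleton]
  have hm : ∀ (s s' a b c d : ℝ), s = s' → a = d → b = c → s * (a * b) = s' * (c * d) := by
    intros; subst_vars; ring
  refine hs _ _ _ _ _ _ ?_ ?_ ?_
  · exact hm _ _ _ _ _ _ (by simp) (h2 _ _ rfl rfl) (h1 _ _ rfl)
  · exact hm _ _ _ _ _ _ (by simp) (h2 _ _ rfl rfl) (h1 _ _ rfl)
  · exact hm _ _ _ _ _ _ (by simp) (h2 _ _ rfl rfl) (h1 _ _ rfl)

theorem wedgeOne_wedgeTwo (σ : Alt E 2) (θ : Alt E 1) (α : Alt E k) :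
    wedgeOne θ (wedgeTwo σ α) = wedgeTwo σ (wedgeOne θ α) := by
  refine wedgeTwo_alt σ _ _ fun u => ?_
  simp only [ContinuousLinearMap.smulRight_apply]
  rw [← wedgeTwoL_apply, ← wedgeTwoL_apply, map_smul]; rfl

theorem extDeriv_wedgeTwo {σ : E → Alt E 2} {α : E → Alt E k} {y : E} (θ : Alt E 1)
    (hσ : DifferentiableAt ℝ σ y) (hα : DifferentiableAt ℝ α y)
    (hd : extDeriv σ y = - wedgeOne θ (σ y)) :
    extDeriv (fun z => wedgeTwo (σ z) (α z)) y =
      wedgeTwo (σ y) (extDeriv α y) - wedgeOne θ (wedgeTwo (σ y) (α y)) := by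
  have h := ((wedgeTwoL (E := E) k).hasFDerivAt.comp y hα.hasFDerivAt).clm_apply hσ.hasFDerivAt
  have h' : fderiv ℝ (fun z => wedgeTwo (σ z) (α z)) y = _ := h.fderiv
  rw [extDeriv, h', alternatizeUncurryFin_add,
    wedgeTwo_alt (σ y) (fderiv ℝ α y) ((((wedgeTwoL k).comp (fderiv ℝ α y)).flip) (σ y))
      (fun u => rfl)]
  have h0 : alternatizeUncurryFin (fderiv ℝ σ y + (oneForm θ).smulRight (σ y)) = 0 := by
    rw [alternatizeUncurryFin_add]
    exact (congrArg (· + wedgeOne θ (σ y)) hd).trans (neg_add_cancel _)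
  have h1 := wedgeTwo_alt_left _ (α y) ((wedgeTwoL k (α y)).comp (fderiv ℝ σ y) +
    (oneForm θ).smulRight (wedgeTwo (σ y) (α y))) (fun u => by
      rw [← wedgeTwoL_apply, ← wedgeTwoL_apply]
      simp) h0
  rw [alternatizeUncurryFin_add] at h1
  rw [show ((wedgeTwoL (E := E) k) ∘ α) y = wedgeTwoL k (α y) from rfl,
    eq_neg_of_add_eq_zero_left h1, neg_add_eq_sub]
  rfl

variable [IsManifold 𝓘(ℝ, E) ∞ M]

/-- A locally conformally symplectic structure: a nondegenerate `2`-form `ω` and a closed `1`-form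
`θ` with `dω = -ω ∧ θ`. -/
structure LCSStructure (E M : Type*) [NormedAddCommGroup E] [NormedSpace ℝ E]
    [TopologicalSpace M] [ChartedSpace E M] [IsManifold 𝓘(ℝ, E) ∞ M] where
  omega : DiffForm E M 2
  theta : DiffForm E M 1
  nondegenerate : ∀ (x : M) (v : TangentSpace 𝓘(ℝ, E) x),
    (∀ w : TangentSpace 𝓘(ℝ, E) x, omega x ![v, w] = (0 : ℝ)) → v = 0
  d_theta : extD 1 theta = 0
  d_omega : extD 2 omega = -(omega.wedge2 1 theta : DiffForm E M 3)

namespace LCSStructure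
variable (S : LCSStructure E M)

/-- The twisted differential `d_l α = dα + l θ ∧ α`. -/
def d (l : ℤ) (j : ℕ) : DiffForm E M j →ₗ[ℝ] DiffForm E M (j + 1) :=
  extD j + (l : ℝ) • S.theta.wedge1 j

/-- `L α = ω ∧ α`. -/
def L (j : ℕ) : DiffForm E M j →ₗ[ℝ] DiffForm E M (j + 2) := S.omega.wedge2 j

theorem extD_L (j : ℕ) (α : DiffForm E M j) :
    extD (j + 2) (S.L j α) = S.L (j + 1) (extD j α) - S.theta.wedge1 (j + 2) (S.L j α) := by
  refine DiffForm.ext_inChart fun x => ?_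
  set y := extChartAt 𝓘(ℝ, E) x x
  have hx : y ∈ (extChartAt 𝓘(ℝ, E) x).target := mem_extChartAt_target (I := 𝓘(ℝ, E)) x
  have hd : extDeriv (inChart S.omega x) y = - wedgeOne (inChart S.theta x y) (inChart S.omega x y) := by
    rw [← inChart_extD S.omega x hx, S.d_omega, ← wedgeTwo_wedgeOne]
    exact congrArg Neg.neg (inChart_wedge2 S.omega S.theta x y)
  have h := extDeriv_wedgeTwo (inChart S.theta x y)
    ((S.omega.contDiffAt_inChart x hx).differentiableAt (by norm_num))
    ((α.contDiffAt_inChart x hx).differentiableAt (by norm_num)) hd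
  refine (inChart_extD _ x hx).trans ?_
  have e : inChart (S.L j α) x = fun z => wedgeTwo (inChart S.omega x z) (inChart α x z) :=
    funext fun z => inChart_wedge2 _ _ _ _
  rw [e, h]
  refine Eq.trans ?_ (congrArg₂ (· - ·) (inChart_wedge2 S.omega (extD j α) x y).symm
    (inChart_wedge1 S.theta (S.L j α) x y).symm)
  rw [inChart_extD _ x hx, e]

theorem wedge1_L (j : ℕ) (α : DiffForm E M j) :
    S.theta.wedge1 (j + 2) (S.L j α) = S.L (j + 1) (S.theta.wedge1 j α) :=
  DiffForm.ext fun x => wedgeOne_wedgeTwo (E := E) (S.omega x) (S.theta x) (α x)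

/-- `d_l L = L d_{l-1}`. -/
theorem d_L (l : ℤ) (j : ℕ) (α : DiffForm E M j) :
    S.d l (j + 2) (S.L j α) = S.L (j + 1) (S.d (l - 1) j α) := by
  simp only [d, LinearMap.add_apply, LinearMap.smul_apply, extD_L, map_add, map_smul, wedge1_L]
  push_cast
  module

end LCSStructure
end
end
section
variable {V W : ℕ → Type*} [∀ j, AddCommGroup (V j)] [∀ j, Module ℝ (V j)]
  [∀ j, AddCommGroup (W j)] [∀ j, Module ℝ (W j)]

/-- The image of the incoming differential; the incoming differential in degree `0` is zero. -/
def coboundaries (d : ∀ j, V j →ₗ[ℝ] V (j + 1)) : ∀ j, Submodule ℝ (V j)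
  | 0 => ⊥
  | j + 1 => LinearMap.range (d j)

/-- `ker (d j)` modulo the image of `d (j - 1)`. -/
abbrev Cohomology (d : ∀ j, V j →ₗ[ℝ] V (j + 1)) (j : ℕ) : Type _ :=
  LinearMap.ker (d j) ⧸ (coboundaries d j).submoduleOf (LinearMap.ker (d j))

/-- The class of a cocycle. -/
def Cohomology.mk (d : ∀ j, V j →ₗ[ℝ] V (j + 1)) (j : ℕ) :
    LinearMap.ker (d j) →ₗ[ℝ] Cohomology d j :=
  Submodule.mkQ _

/-- The map `[a] ↦ [f a]` induced on cohomology by a linear map which sends cocycles to cocycles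
and coboundaries to coboundaries. -/
def Cohomology.map (d : ∀ j, V j →ₗ[ℝ] V (j + 1)) (e : ∀ j, W j →ₗ[ℝ] W (j + 1)) {i j : ℕ}
    (f : V i →ₗ[ℝ] W j) (hker : ∀ a ∈ LinearMap.ker (d i), f a ∈ LinearMap.ker (e j))
    (hcob : ∀ a ∈ coboundaries d i, f a ∈ coboundaries e j) :
    Cohomology d i →ₗ[ℝ] Cohomology e j :=
  Submodule.mapQ _ _ (f.restrict hker) fun a ha => hcob a ha
end

section
variable {E : Type*} [NormedAddCommGroup E] [NormedSpace ℝ E]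
  {M : Type*} [TopologicalSpace M] [ChartedSpace E M] [IsManifold 𝓘(ℝ, E) ∞ M]

/-- Transport of forms along an equality of degrees. -/
def castDeg {a b : ℕ} (h : a = b) : DiffForm E M a →ₗ[ℝ] DiffForm E M b :=
  h ▸ LinearMap.id

namespace LCSStructure
variable (S : LCSStructure E M)

/-- The power `L^p`. -/
def Lpow : ∀ p j : ℕ, DiffForm E M j →ₗ[ℝ] DiffForm E M (j + 2 * p)
  | 0, _ => LinearMap.id
  | p + 1, j => S.L (j + 2 * p) ∘ₗ Lpow p j

/-- The filtration `F^p Ω^m = L^p Ω^{m - 2p}`, which is zero if `m < 2p`. -/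
def filtration : ℕ → ∀ m : ℕ, Submodule ℝ (DiffForm E M m)
  | 0, _ => ⊤
  | _ + 1, 0 => ⊥
  | _ + 1, 1 => ⊥
  | p + 1, m + 2 => (filtration p m).map (S.L m)

theorem d_mem_filtration (p : ℕ) : ∀ (l : ℤ) (m : ℕ) (α : DiffForm E M m),
    α ∈ S.filtration p m → S.d l m α ∈ S.filtration p (m + 1) := by
  induction p with
  | zero => exact fun l m α _ => Submodule.mem_top
  | succ p ih =>
    intro l m α h
    match m, α, h with
    | 0, α, h => rw [(Submodule.mem_bot ℝ).1 h, map_zero]; exact zero_mem _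
    | 1, α, h => rw [(Submodule.mem_bot ℝ).1 h, map_zero]; exact zero_mem _
    | m + 2, _, ⟨β, hβ, rfl⟩ => exact ⟨_, ih (l - 1) m β hβ, (S.d_L l m β).symm⟩

/-- `E_0^{p,q} = F^p Ω^{p+q} / F^{p+1} Ω^{p+q}`. -/
def E0 (p q : ℕ) : Type _ :=
  S.filtration p (p + q) ⧸ (S.filtration (p + 1) (p + q)).submoduleOf (S.filtration p (p + q))

instance (p q : ℕ) : AddCommGroup (S.E0 p q) := inferInstanceAs (AddCommGroup (_ ⧸ _))

instance (p q : ℕ) : Module ℝ (S.E0 p q) := inferInstanceAs (Module ℝ (_ ⧸ _))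

/-- The quotient map `F^p Ω^{p+q} → E_0^{p,q}`. -/
def E0.mk (p q : ℕ) : S.filtration p (p + q) →ₗ[ℝ] S.E0 p q := Submodule.mkQ _

/-- The differential `E_{l,0}^{p,q} → E_{l,0}^{p,q+1}` induced by `d_l`. -/
def d0 (l : ℤ) (p q : ℕ) : S.E0 p q →ₗ[ℝ] S.E0 p (q + 1) :=
  Submodule.mapQ _ _ ((S.d l (p + q)).restrict (S.d_mem_filtration p l (p + q)))
    fun a ha => S.d_mem_filtration (p + 1) l (p + q) a ha

/-- The term `E_{l,1}^{p,q}` of the spectral sequence of the complex `(Ω^*, d_l)` filtered by `F`. -/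
abbrev E1 (l : ℤ) (p q : ℕ) : Type _ := Cohomology (S.d0 l p) q

/-- The Lichnerowicz–Novikov cohomology `H^j_l = H^j(Ω^*, d_l)`. -/
abbrev H (l : ℤ) (j : ℕ) : Type _ := Cohomology (S.d l) j

/-- `L^p : Ω^j → Ω^m` where `m = j + 2p`. -/
def LpowTo (p j m : ℕ) (h : j + 2 * p = m) : DiffForm E M j →ₗ[ℝ] DiffForm E M m :=
  castDeg h ∘ₗ S.Lpow p j

theorem LpowTo_succ (p j m : ℕ) (h : j + 2 * p = m) (h' : j + 2 * (p + 1) = m + 2)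
    (α : DiffForm E M j) : S.LpowTo (p + 1) j (m + 2) h' α = S.L m (S.LpowTo p j m h α) := by
  subst h; rfl

theorem LpowTo_mem (p : ℕ) : ∀ (j m : ℕ) (h : j + 2 * p = m) (α : DiffForm E M j),
    S.LpowTo p j m h α ∈ S.filtration p m := by
  induction p with
  | zero => exact fun j m h α => Submodule.mem_top
  | succ p ih =>
    rintro j _ rfl α
    change S.LpowTo (p + 1) j (j + 2 * p + 2) rfl α ∈ S.filtration (p + 1) (j + 2 * p + 2)
    rw [S.LpowTo_succ p j (j + 2 * p) rfl rfl]
    exact ⟨_, ih j _ rfl α, rfl⟩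

theorem d_LpowTo (l : ℤ) (p : ℕ) : ∀ (j m : ℕ) (h : j + 2 * p = m) (h' : j + 1 + 2 * p = m + 1)
    (α : DiffForm E M j),
    S.d (l + p) m (S.LpowTo p j m h α) = S.LpowTo p (j + 1) (m + 1) h' (S.d l j α) := by
  induction p with
  | zero =>
    rintro j _ rfl h' α
    simp only [Nat.cast_zero, add_zero]
    rfl
  | succ p ih =>
    rintro j _ rfl h' α
    have h2 : j + 1 + 2 * p = j + 2 * p + 1 := by omega
    refine Eq.trans ?_ (S.LpowTo_succ p (j + 1) (j + 2 * p + 1) h2 h' _).symm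
    refine Eq.trans (congrArg _ (S.LpowTo_succ p j (j + 2 * p) rfl rfl α)) ?_
    refine (S.d_L _ _ _).trans ?_
    rw [← ih j _ rfl h2, Nat.cast_succ, ← add_assoc, add_sub_cancel_right]
    rfl

/-- The map `Ω^j → E_0^{p,p+j}`, `β ↦ [L^p β]`. -/
def toE0 (p j : ℕ) : DiffForm E M j →ₗ[ℝ] S.E0 p (p + j) :=
  E0.mk S p (p + j) ∘ₗ (S.LpowTo p j (p + (p + j)) (by omega)).codRestrict _ (S.LpowTo_mem p j _ _)

theorem d0_toE0 (l : ℤ) (p j : ℕ) (α : DiffForm E M j) :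
    S.d0 (l + p) p (p + j) (S.toE0 p j α) = S.toE0 p (j + 1) (S.d l j α) := by
  refine congrArg (E0.mk S p (p + (j + 1))) (Subtype.ext ?_)
  exact S.d_LpowTo l p j (p + (p + j)) (by omega) (by omega) α

/-- The map `H^j_{l-1} → H^{j+2}_l`, `[η] ↦ [L η]`. -/
def Lbar (l : ℤ) (j : ℕ) : S.H (l - 1) j →ₗ[ℝ] S.H l (j + 2) :=
  Cohomology.map (S.d (l - 1)) (S.d l) (S.L j)
    (fun a ha => by
      rw [LinearMap.mem_ker] at ha ⊢
      rw [S.d_L, ha, map_zero])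
    (fun a ha => by
      match j, a, ha with
      | 0, a, ha => rw [(Submodule.mem_bot ℝ).1 ha, map_zero]; exact zero_mem _
      | j + 1, _, ⟨b, rfl⟩ => exact ⟨S.L j b, S.d_L l j b⟩)

/-- The map `H^j_l → E_{l+p,1}^{p,p+j}`, `[β] ↦ [L^p β]`. -/
def LbarP (l : ℤ) (p j : ℕ) : S.H l j →ₗ[ℝ] S.E1 (l + p) p (p + j) :=
  Cohomology.map (S.d l) (S.d0 (l + p) p) (S.toE0 p j)
    (fun a ha => by
      rw [LinearMap.mem_ker] at ha ⊢
      rw [S.d0_toE0, ha, map_zero])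
    (fun a ha => by
      match j, a, ha with
      | 0, a, ha => rw [(Submodule.mem_bot ℝ).1 ha, map_zero]; exact zero_mem _
      | j + 1, _, ⟨b, rfl⟩ => exact ⟨S.toE0 p j b, S.d0_toE0 l p j b⟩)

/-- `δ : E_{l+p,1}^{p,p+j+1} → H^j_{l-1}` is the connecting homomorphism: every cocycle of
`E_0^{p,p+j+1}` can be written `[L^p α]` with `d_l α = L η` and `d_{l-1} η = 0`, and for every such
choice of `α` and `η` the map `δ` sends its class to `[η]`. -/
def IsConnecting (l : ℤ) (p j : ℕ) (δ : S.E1 (l + p) p (p + (j + 1)) →ₗ[ℝ] S.H (l - 1) j) :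
    Prop :=
  ∀ z : LinearMap.ker (S.d0 (l + p) p (p + (j + 1))),
    (∃ (α : DiffForm E M (j + 1)) (η : LinearMap.ker (S.d (l - 1) j)),
      (z : S.E0 p (p + (j + 1))) = S.toE0 p (j + 1) α ∧ S.d l (j + 1) α = S.L j η) ∧
    ∀ (α : DiffForm E M (j + 1)) (η : LinearMap.ker (S.d (l - 1) j)),
      (z : S.E0 p (p + (j + 1))) = S.toE0 p (j + 1) α → S.d l (j + 1) α = S.L j η →
        δ (Cohomology.mk (S.d0 (l + p) p) (p + (j + 1)) z) = Cohomology.mk (S.d (l - 1)) j η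

/-- The primitive `k`-forms on a manifold of dimension `2n`: the kernel of `L^{n-k+1}` if `k ≤ n`,
and zero if `k > n`. -/
def primitive (n k : ℕ) : Submodule ℝ (DiffForm E M k) :=
  if k ≤ n then LinearMap.ker (S.Lpow (n - k + 1) k) else ⊥

open Classical in
/-- The projection `Ω^k → P^k` along `L Ω^{k-2}`, when `Ω^k` is the direct sum of the two. -/
def primProj (n k : ℕ) : DiffForm E M k →ₗ[ℝ] S.primitive n k :=
  if h : IsCompl (S.primitive n k) (S.filtration 1 k) then Submodule.projectionOnto _ _ h else 0

/-- The operator `d_l^+ : P^j → P^{j+1}`, which is `d_l` followed by the projection to `P^{j+1}`. -/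
def dplus (n : ℕ) (l : ℤ) (j : ℕ) : S.primitive n j →ₗ[ℝ] S.primitive n (j + 1) :=
  S.primProj n (j + 1) ∘ₗ S.d l j ∘ₗ (S.primitive n j).subtype

end LCSStructure
end
end LCS

end

open LCS

/-!
Everything rests on the Lefschetz operator `L = σ ∧ ·` of a nondegenerate `2`-form `σ` on a vector
space of dimension `2n`. If `σ ^ p ∧ α = 0` with `deg α + p ≤ n`, contracting `σ ^ (p + 1) ∧ α = 0`
with a vector `v` gives `σ ^ (p + 1) ∧ ι_v α = 0`, so `α = 0` by induction on the degree. In degree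
zero, contracting `σ ^ p ∧ α = 0` gives `(ι_v σ) ∧ σ ^ (p - 1) ∧ α = 0` for all `v`, and a form of
degree less than `2n` annihilated by every `1`-form vanishes, so `σ ^ (p - 1) ∧ α = 0`. Hence
`L ^ p` is injective on `j`-forms for `j + p ≤ n`, and by a count of dimensions bijective for
`j + p = n`; inverting it pointwise is a smooth operation, so this passes to differential forms.

Injectivity of `L ^ p` identifies `E_0^{p,p+j}` with `Ω^j / L Ω^{j-2}` for `j + p ≤ n`, and
bijectivity of `L ^ (n - j + 2)` on `Ω^{j-2}` makes the primitive forms a complement of `L Ω^{j-2}`.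
The long exact sequence is that of `0 → Ω^{*-2} → Ω^* → E_0^{p,p+*} → 0`, with first map `L`, in
the range of degrees where this sequence is exact.
-/

noncomputable section

namespace LCS

section Contraction

open ContinuousAlternatingMap

variable {E : Type*} [NormedAddCommGroup E] [NormedSpace ℝ E] {k : ℕ}

theorem removeNth_succ_vecCons {X : Type*} {m : ℕ} (x : X) (u : Fin (m + 1) → X) (i : Fin (m + 1)) :
    i.succ.removeNth (Matrix.vecCons x u) = Matrix.vecCons x (i.removeNth u) := by
  ext j
  refine Fin.cases ?_ (fun j => ?_) j <;> simp [Fin.removeNth]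

theorem curryLeft_wedgeOne_zero (θ : Alt E 1) (α : Alt E 0) (v : E) :
    (wedgeOne θ α).curryLeft v = θ ![v] • α := by
  ext u
  refine (wedgeOne_apply θ α (Matrix.vecCons v u)).trans ?_
  rw [Fin.sum_univ_one]
  simp [Fin.removeNth_zero]

theorem curryLeft_wedgeOne (θ : Alt E 1) (α : Alt E (k + 1)) (v : E) :
    (wedgeOne θ α).curryLeft v = θ ![v] • α - wedgeOne θ (α.curryLeft v) := by
  ext u
  refine (wedgeOne_apply θ α (Matrix.vecCons v u)).trans ?_
  have hα : wedgeOne θ (α.curryLeft v) u = _ := wedgeOne_apply θ (α.curryLeft v) u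
  rw [ContinuousAlternatingMap.sub_apply, ContinuousAlternatingMap.smul_apply, hα,
    Fin.sum_univ_succ, sub_eq_add_neg, ← Finset.sum_neg_distrib]
  refine congrArg₂ (· + ·) (by simp [Fin.removeNth_zero]) (Finset.sum_congr rfl fun i _ => ?_)
  rw [removeNth_succ_vecCons]
  simp [pow_succ]

theorem curryLeft_wedgeTwo_zero (σ : Alt E 2) (α : Alt E 0) (v : E) :
    (wedgeTwo σ α).curryLeft v = wedgeOne (σ.curryLeft v) α := by
  ext u
  refine (wedgeTwo_apply σ α (Matrix.vecCons v u)).trans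
    (Eq.trans ?_ (wedgeOne_apply (σ.curryLeft v) α u).symm)
  rw [Fin.sum_univ_one, Fin.sum_univ_one, show Finset.Ici (0 : Fin 1) = {0} by decide,
    Finset.sum_singleton]
  rfl

theorem curryLeft_wedgeTwo (σ : Alt E 2) (α : Alt E (k + 1)) (v : E) :
    (wedgeTwo σ α).curryLeft v =
      wedgeTwo σ (α.curryLeft v) + wedgeOne (σ.curryLeft v) α := by
  ext u
  refine (wedgeTwo_apply σ α (Matrix.vecCons v u)).trans ?_
  have hσ : wedgeOne (σ.curryLeft v) α u = _ := wedgeOne_apply (σ.curryLeft v) α u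
  have hα : wedgeTwo σ (α.curryLeft v) u = _ := wedgeTwo_apply σ (α.curryLeft v) u
  rw [ContinuousAlternatingMap.add_apply, hσ, hα, Fin.sum_univ_succ, add_comm]
  refine congrArg₂ (· + ·) (Finset.sum_congr rfl fun i _ => ?_) ?_
  · have hIci : Finset.Ici i.succ = (Finset.Ici i).map (Fin.succEmb (k + 1)) := by
      ext j
      refine Fin.cases ?_ (fun j => ?_) j <;> simp
    rw [hIci, Finset.sum_map]
    refine Finset.sum_congr rfl fun j _ => ?_
    rw [Fin.coe_succEmb, Fin.castSucc_succ, removeNth_succ_vecCons, removeNth_succ_vecCons]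
    simp [pow_succ, pow_add]
  · rw [show Finset.Ici (0 : Fin (k + 2)) = Finset.univ by ext; simp]
    refine Finset.sum_congr rfl fun i _ => ?_
    simp [Fin.removeNth_zero]

variable {ι : Type*} [Fintype ι]

theorem sum_wedgeOne_curryLeft {f : ι → Alt E 1} {b : ι → E} (hf : ∀ v, ∑ i, f i ![v] • b i = v)
    (α : Alt E (k + 1)) :
    ∑ i, wedgeOne (f i) (α.curryLeft (b i)) = ((k + 1 : ℕ) : ℝ) • α := by
  have hα : ∑ i, (oneForm (f i)).smulRight (α.curryLeft (b i)) = α.curryLeft := by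
    ext v : 1
    conv_rhs => rw [← hf v]
    simp [oneForm_apply]
  calc ∑ i, wedgeOne (f i) (α.curryLeft (b i))
      = alternatizeUncurryFinCLM ℝ E ℝ
          (∑ i, (oneForm (f i)).smulRight (α.curryLeft (b i))) := by
        rw [_root_.map_sum]
        rfl
    _ = ((k + 1 : ℕ) : ℝ) • α := by
        rw [hα, alternatizeUncurryFinCLM_apply, alternatizeUncurryFin_curryLeft,
          Nat.cast_smul_eq_nsmul]

-- Contracting `fᵢ ∧ α` with `bᵢ` and summing over `i` gives `(dim E - deg α) α`.
theorem eq_zero_of_wedgeOne_eq_zero (b : Module.Basis ι ℝ E) {f : ι → Alt E 1}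
    (hf : ∀ i v, f i ![v] = b.repr v i) (hk : k ≠ Fintype.card ι) {α : Alt E k}
    (hα : ∀ i, wedgeOne (f i) α = 0) : α = 0 := by
  have hb : ∀ v, ∑ i, f i ![v] • b i = v := fun v => by simp only [hf, b.sum_repr]
  have htrace : ∑ i, f i ![b i] = (Fintype.card ι : ℝ) := by simp [hf]
  have hsum : ∑ i, (wedgeOne (f i) α).curryLeft (b i) = ((Fintype.card ι : ℝ) - k) • α := by
    cases k with
    | zero =>
      simp only [curryLeft_wedgeOne_zero, ← Finset.sum_smul, htrace, Nat.cast_zero, sub_zero]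
    | succ k =>
      simp only [curryLeft_wedgeOne, Finset.sum_sub_distrib, ← Finset.sum_smul, htrace, sub_smul,
        sum_wedgeOne_curryLeft hb]
  rw [Finset.sum_eq_zero fun i _ => by rw [hα]; rfl] at hsum
  exact (smul_eq_zero.1 hsum.symm).resolve_left (sub_ne_zero.2 (by exact_mod_cast hk.symm))

end Contraction

section Dimension

variable {E : Type*} [NormedAddCommGroup E] [NormedSpace ℝ E] [FiniteDimensional ℝ E] {k : ℕ}

theorem continuous_multilinearMap {ι F : Type*} [Finite ι] [AddCommGroup F] [Module ℝ F]
    [TopologicalSpace F] [ContinuousAdd F] [ContinuousSMul ℝ F]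
    (f : MultilinearMap ℝ (fun _ : ι => E) F) : Continuous f := by
  classical
  have := Fintype.ofFinite ι
  let b := Module.finBasis ℝ E
  have hf : ⇑f = fun v => ∑ r : ι → Fin (Module.finrank ℝ E),
      (∏ i, b.repr (v i) (r i)) • f fun i => b (r i) := by
    ext v
    conv_lhs => rw [funext fun i => (b.sum_repr (v i)).symm, f.map_sum]
    simp only [f.map_smul_univ]
  have hcoord : ∀ j, Continuous fun x => b.repr x j := fun j =>
    (b.coord j).continuous_of_finiteDimensional
  rw [hf]
  fun_prop

/-- Alternating `k`-forms on a finite-dimensional space, as the dual of the `k`-th exterior power.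
It is used to compute the dimension of the space of forms. -/
def altEquivDual (E : Type*) [NormedAddCommGroup E] [NormedSpace ℝ E] [FiniteDimensional ℝ E]
    (k : ℕ) : Alt E k ≃ₗ[ℝ] Module.Dual ℝ (⋀[ℝ]^k E) :=
  LinearEquiv.ofBijective ContinuousAlternatingMap.toAlternatingMapLinear
    ⟨ContinuousAlternatingMap.toAlternatingMap_injective, fun f =>
      ⟨{ f with cont := continuous_multilinearMap f.toMultilinearMap }, rfl⟩⟩ ≪≫ₗ
    exteriorPower.alternatingMapLinearEquiv

instance : FiniteDimensional ℝ (Alt E k) := (altEquivDual E k).symm.finiteDimensional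

theorem finrank_alt : Module.finrank ℝ (Alt E k) = (Module.finrank ℝ E).choose k := by
  rw [(altEquivDual E k).finrank_eq, Subspace.dual_finrank_eq, exteriorPower.finrank_eq]

theorem subsingleton_alt (hk : Module.finrank ℝ E < k) : Subsingleton (Alt E k) :=
  Module.finrank_zero_iff.1 (finrank_alt.trans (Nat.choose_eq_zero_of_lt hk))

end Dimension

section Lefschetz

open scoped DirectSum

variable {E : Type*} [NormedAddCommGroup E] [NormedSpace ℝ E] {k : ℕ}

/-- The operator `α ↦ σ ^ p ∧ α` from `k`-forms to `(k + 2 * p)`-forms on a vector space. -/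
def wedgePow (σ : Alt E 2) : ∀ p k : ℕ, Alt E k →L[ℝ] Alt E (k + 2 * p)
  | 0, _ => ContinuousLinearMap.id ℝ _
  | p + 1, k => (wedgeTwoL (k + 2 * p)).flip σ ∘L wedgePow σ p k

theorem wedgePow_succ_apply (σ : Alt E 2) (p k : ℕ) (α : Alt E k) :
    wedgePow σ (p + 1) k α = wedgeTwo σ (wedgePow σ p k α) := rfl

/-- The forms of all degrees on a vector space. Working in this direct sum avoids transporting
forms between the propositionally equal degrees `(k + 1) + 2 * p` and `(k + 2 * p) + 1`. -/
abbrev AltSum (E : Type*) [NormedAddCommGroup E] [NormedSpace ℝ E] : Type _ := ⨁ k, Alt E k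

/-- A `k`-form as an element of the direct sum of all degrees. -/
abbrev ofAlt (k : ℕ) : Alt E k →ₗ[ℝ] AltSum E := DirectSum.lof ℝ ℕ (Alt E) k

theorem ofAlt_injective (k : ℕ) : Function.Injective (ofAlt (E := E) k) :=
  DirectSum.of_injective k

/-- The Lefschetz operator `α ↦ σ ∧ α` on forms of all degrees. -/
def lefschetz (σ : Alt E 2) : Module.End ℝ (AltSum E) :=
  DirectSum.toModule ℝ ℕ _ fun k => ofAlt (k + 2) ∘ₗ ((wedgeTwoL k).flip σ).toLinearMap

/-- The exterior multiplication `α ↦ θ ∧ α` on forms of all degrees. -/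
def exteriorMul (θ : Alt E 1) : Module.End ℝ (AltSum E) :=
  DirectSum.toModule ℝ ℕ _ fun k => ofAlt (k + 1) ∘ₗ (wedgeOneL k θ).toLinearMap

/-- The interior multiplication `α ↦ ι_v α` on forms of all degrees, which is zero on functions. -/
def interiorMul (v : E) : Module.End ℝ (AltSum E) :=
  DirectSum.toModule ℝ ℕ _ fun
    | 0 => 0
    | k + 1 => ofAlt k ∘ₗ LinearMap.applyₗ v ∘ₗ ContinuousLinearMap.coeLM ℝ ∘ₗ
        (ContinuousAlternatingMap.curryLeftLI (𝕜 := ℝ) (E := E) (F := ℝ)).toLinearMap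

theorem lefschetz_ofAlt (σ : Alt E 2) (α : Alt E k) :
    lefschetz σ (ofAlt k α) = ofAlt (k + 2) (wedgeTwo σ α) :=
  DirectSum.toModule_lof ..

theorem exteriorMul_ofAlt (θ : Alt E 1) (α : Alt E k) :
    exteriorMul θ (ofAlt k α) = ofAlt (k + 1) (wedgeOne θ α) :=
  DirectSum.toModule_lof ..

theorem interiorMul_ofAlt_zero (v : E) (α : Alt E 0) : interiorMul v (ofAlt 0 α) = 0 :=
  DirectSum.toModule_lof ..

theorem interiorMul_ofAlt_succ (v : E) (α : Alt E (k + 1)) :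
    interiorMul v (ofAlt (k + 1) α) = ofAlt k (α.curryLeft v) :=
  DirectSum.toModule_lof ..

theorem lefschetz_pow_ofAlt (σ : Alt E 2) (p : ℕ) (α : Alt E k) :
    (lefschetz σ ^ p) (ofAlt k α) = ofAlt (k + 2 * p) (wedgePow σ p k α) := by
  induction p with
  | zero => rfl
  | succ p ih =>
    rw [pow_succ', Module.End.mul_apply, ih, lefschetz_ofAlt, ← wedgePow_succ_apply]
    rfl

theorem commute_lefschetz_exteriorMul (σ : Alt E 2) (θ : Alt E 1) :
    Commute (lefschetz σ) (exteriorMul θ) :=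
  DirectSum.linearMap_ext _ fun k => LinearMap.ext fun α => by
    simp only [LinearMap.comp_apply, Module.End.mul_apply, lefschetz_ofAlt, exteriorMul_ofAlt,
      wedgeOne_wedgeTwo]

theorem interiorMul_mul_lefschetz (σ : Alt E 2) (v : E) :
    interiorMul v * lefschetz σ =
      lefschetz σ * interiorMul v + exteriorMul (σ.curryLeft v) :=
  DirectSum.linearMap_ext _ fun k => LinearMap.ext fun α => by
    simp only [LinearMap.comp_apply, LinearMap.add_apply, Module.End.mul_apply, lefschetz_ofAlt,
      exteriorMul_ofAlt, interiorMul_ofAlt_succ]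
    cases k with
    | zero =>
      rw [interiorMul_ofAlt_zero, map_zero, curryLeft_wedgeTwo_zero]
      exact (zero_add _).symm
    | succ k => rw [interiorMul_ofAlt_succ, lefschetz_ofAlt, ← map_add, curryLeft_wedgeTwo]

theorem interiorMul_mul_lefschetz_pow (σ : Alt E 2) (v : E) (p : ℕ) :
    interiorMul v * lefschetz σ ^ (p + 1) =
      lefschetz σ ^ (p + 1) * interiorMul v +
        ((p : ℝ) + 1) • (exteriorMul (σ.curryLeft v) * lefschetz σ ^ p) := by
  induction p with
  | zero => simp [interiorMul_mul_lefschetz]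
  | succ p ih =>
    rw [pow_succ (lefschetz σ) (p + 1), ← mul_assoc, ih, add_mul, mul_assoc,
      interiorMul_mul_lefschetz, smul_mul_assoc, mul_assoc, ← pow_succ, mul_add, ← mul_assoc,
      ((commute_lefschetz_exteriorMul σ _).pow_left (p + 1)).eq, ← pow_succ]
    push_cast
    module

/-- Nondegeneracy of a `2`-form on a vector space. -/
def Nondeg (σ : Alt E 2) : Prop := ∀ v, (∀ w, σ ![v, w] = 0) → v = 0

namespace Nondeg

variable [FiniteDimensional ℝ E] {σ : Alt E 2}

theorem exists_forall_apply_eq (hσ : Nondeg σ) (f : Module.Dual ℝ E) :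
    ∃ w, ∀ v, σ ![w, v] = f v := by
  let B : E →ₗ[ℝ] Module.Dual ℝ E :=
    LinearMap.mk₂ ℝ (fun v w => oneForm (σ.curryLeft v) w) (by simp [oneForm_apply])
      (by simp [oneForm_apply]) (by simp) (by simp)
  have hB : ∀ v w, B v w = σ ![v, w] := fun v w => oneForm_apply (σ.curryLeft v) w
  have hinj : Function.Injective B := (injective_iff_map_eq_zero B).2 fun v hv =>
    hσ v fun w => by rw [← hB, hv, LinearMap.zero_apply]
  obtain ⟨w, hw⟩ := (LinearMap.injective_iff_surjective_of_finrank_eq_finrank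
    Subspace.dual_finrank_eq.symm).1 hinj f
  exact ⟨w, fun v => by rw [← hB, hw]⟩

theorem eq_zero_of_wedgeOne_curryLeft_eq_zero (hσ : Nondeg σ) (hk : k ≠ Module.finrank ℝ E)
    {α : Alt E k} (hα : ∀ v, wedgeOne (σ.curryLeft v) α = 0) : α = 0 := by
  let b := Module.finBasis ℝ E
  choose w hw using fun i => hσ.exists_forall_apply_eq (b.coord i)
  exact eq_zero_of_wedgeOne_eq_zero b (f := fun i => σ.curryLeft (w i)) hw
    (by rwa [Fintype.card_fin]) fun i => hα (w i)

theorem eq_zero_of_wedgePow_eq_zero_of_degree_zero (hσ : Nondeg σ) {p : ℕ}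
    (hp : 2 * p ≤ Module.finrank ℝ E) {α : Alt E 0} (hα : wedgePow σ p 0 α = 0) : α = 0 := by
  induction p with
  | zero => exact hα
  | succ p ih =>
    refine ih (by omega)
      (hσ.eq_zero_of_wedgeOne_curryLeft_eq_zero (by omega) fun v => ?_)
    have hcomm := LinearMap.congr_fun (interiorMul_mul_lefschetz_pow σ v p) (ofAlt 0 α)
    simp only [LinearMap.add_apply, LinearMap.smul_apply, Module.End.mul_apply,
      lefschetz_pow_ofAlt, interiorMul_ofAlt_zero, exteriorMul_ofAlt, hα, map_zero,
      zero_add] at hcomm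
    have hp0 : (p : ℝ) + 1 ≠ 0 := by positivity
    exact (map_eq_zero_iff _ (ofAlt_injective _)).1
      ((smul_eq_zero.1 hcomm.symm).resolve_left hp0)

-- If `σ ^ p ∧ α = 0`, contracting `σ ^ (p + 1) ∧ α = 0` with `v` leaves `σ ^ (p + 1) ∧ ι_v α = 0`.
theorem eq_zero_of_wedgePow_eq_zero (hσ : Nondeg σ) {p : ℕ}
    (hp : 2 * (k + p) ≤ Module.finrank ℝ E) {α : Alt E k} (hα : wedgePow σ p k α = 0) :
    α = 0 := by
  induction k generalizing p with
  | zero => exact hσ.eq_zero_of_wedgePow_eq_zero_of_degree_zero (by omega) hα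
  | succ k ih =>
    have hcurry : ∀ v, α.curryLeft v = 0 := by
      refine fun v => ih (p := p + 1) (by omega) ((map_eq_zero_iff _ (ofAlt_injective _)).1 ?_)
      have hcomm := LinearMap.congr_fun (interiorMul_mul_lefschetz_pow σ v p) (ofAlt (k + 1) α)
      simp only [LinearMap.add_apply, LinearMap.smul_apply, Module.End.mul_apply, pow_succ',
        lefschetz_pow_ofAlt, interiorMul_ofAlt_succ, lefschetz_ofAlt, hα, map_zero,
        smul_zero, add_zero] at hcomm
      exact hcomm.symm
    ext u
    rw [← Matrix.cons_head_tail u]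
    exact congrArg (fun β : Alt E k => β (Matrix.vecTail u)) (hcurry (Matrix.vecHead u))

theorem wedgePow_injective (hσ : Nondeg σ) {p : ℕ} (hp : 2 * (k + p) ≤ Module.finrank ℝ E) :
    Function.Injective (wedgePow σ p k) :=
  (injective_iff_map_eq_zero _).2 fun _ => hσ.eq_zero_of_wedgePow_eq_zero hp

theorem wedgePow_isInvertible (hσ : Nondeg σ) {q : ℕ} (hq : 2 * (k + q) = Module.finrank ℝ E) :
    (wedgePow σ q k).IsInvertible := by
  have hrank : Module.finrank ℝ (Alt E k) = Module.finrank ℝ (Alt E (k + 2 * q)) := by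
    rw [finrank_alt, finrank_alt]
    exact Nat.choose_symm_of_eq_add (by omega)
  refine ⟨(LinearEquiv.ofInjectiveOfFinrankEq (wedgePow σ q k).toLinearMap
    (hσ.wedgePow_injective hq.le) hrank).toContinuousLinearEquiv, ?_⟩
  ext; rfl

end Nondeg

theorem wedgePow_comp (σ : Alt E 2) (g : E →L[ℝ] E) (p k : ℕ) (α : Alt E k) :
    wedgePow (σ.compContinuousLinearMap g) p k (α.compContinuousLinearMap g) =
      (wedgePow σ p k α).compContinuousLinearMap g := by
  induction p with
  | zero => rfl
  | succ p ih => rw [wedgePow_succ_apply, ih]; exact wedgeTwo_comp σ _ g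

theorem contDiff_wedgePow (p k : ℕ) : ContDiff ℝ ∞ fun σ : Alt E 2 => wedgePow σ p k := by
  induction p with
  | zero => exact contDiff_const
  | succ p ih => exact (ContinuousLinearMap.contDiff _).clm_comp ih

end Lefschetz

section ExteriorDerivative

open ContinuousAlternatingMap

variable {E : Type*} [NormedAddCommGroup E] [NormedSpace ℝ E] {k : ℕ}

theorem wedgeOne_wedgeOne_self (θ : Alt E 1) (α : Alt E k) : wedgeOne θ (wedgeOne θ α) = 0 := by
  have h := alt_smulRight_swap (oneForm θ) ((oneForm θ).smulRight α)
  rw [alternatizeUncurryFin_alternatizeUncurryFinCLM_comp_of_symmetric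
    (by intro x y; simp [smul_smul, mul_comm])] at h
  exact neg_eq_zero.1 h.symm

theorem apply_swap_of_alternatizeUncurryFin_eq_zero {B : E →L[ℝ] Alt E 1}
    (hB : alternatizeUncurryFin B = 0) (u v : E) : B u ![v] = B v ![u] := by
  have huv : ∑ i : Fin 2, (-1) ^ (i : ℕ) • B (![u, v] i) (i.removeNth ![u, v]) = 0 :=
    (alternatizeUncurryFin_apply B ![u, v]).symm.trans
      (congrArg (fun f : Alt E 2 => f ![u, v]) hB)
  have h0 : (0 : Fin 2).removeNth ![u, v] = ![v] := by ext i; fin_cases i; rfl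
  have h1 : (1 : Fin 2).removeNth ![u, v] = ![u] := by ext i; fin_cases i; rfl
  rw [Fin.sum_univ_two, h0, h1] at huv
  simpa [← sub_eq_add_neg, sub_eq_zero] using huv

theorem extDeriv_wedgeOne {θ : E → Alt E 1} {α : E → Alt E k} {y : E}
    (hθ : DifferentiableAt ℝ θ y) (hα : DifferentiableAt ℝ α y) (hd : extDeriv θ y = 0) :
    extDeriv (fun z => wedgeOne (θ z) (α z)) y = -wedgeOne (θ y) (extDeriv α y) := by
  have hfderiv : fderiv ℝ (fun z => wedgeOne (θ z) (α z)) y = _ :=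
    (((wedgeOneL (E := E) k).hasFDerivAt.comp y hθ.hasFDerivAt).clm_apply hα.hasFDerivAt).fderiv
  have hθ0 : alternatizeUncurryFin (((wedgeOneL k).comp (fderiv ℝ θ y)).flip (α y)) = 0 := by
    let B : E →L[ℝ] E →L[ℝ] Alt E k :=
      (ContinuousLinearMap.smulRightL ℝ E (Alt E k)).flip (α y) ∘L
        ((ofSubsingletonLIE (𝕜 := ℝ) (E := E) (F := ℝ) (0 : Fin 1)).symm :
          Alt E 1 →L[ℝ] E →L[ℝ] ℝ) ∘L fderiv ℝ θ y
    have hB : ∀ u v, B u v = fderiv ℝ θ y u ![v] • α y := fun u v => by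
      rw [← oneForm_apply]; rfl
    refine alternatizeUncurryFin_alternatizeUncurryFinCLM_comp_of_symmetric (f := B) fun u v => ?_
    rw [hB, hB, apply_swap_of_alternatizeUncurryFin_eq_zero hd]
  rw [extDeriv, hfderiv, alternatizeUncurryFin_add]
  exact (congrArg (_ + ·) hθ0).trans
    ((add_zero _).trans (alt_smulRight_swap (oneForm (θ y)) (fderiv ℝ α y)))

end ExteriorDerivative

section DifferentialForms

variable {E : Type*} [NormedAddCommGroup E] [NormedSpace ℝ E]
  {M : Type*} [TopologicalSpace M] [ChartedSpace E M] [IsManifold 𝓘(ℝ, E) ∞ M] {k : ℕ}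

theorem extD_extD (α : DiffForm E M k) : extD (k + 1) (extD k α) = 0 := by
  refine DiffForm.ext_inChart fun x => ?_
  have hx := mem_extChartAt_target (I := 𝓘(ℝ, E)) x
  have hα : inChart (extD k α) x =ᶠ[𝓝 (extChartAt 𝓘(ℝ, E) x x)] extDeriv (inChart α x) := by
    filter_upwards [(isOpen_extChartAt_target (I := 𝓘(ℝ, E)) x).mem_nhds hx] with y hy
    exact inChart_extD α x hy
  have hr : minSmoothness ℝ 2 ≤ (∞ : WithTop ℕ∞) := by
    rw [minSmoothness_of_isRCLikeNormedField]; exact ENat.LEInfty.out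
  refine (inChart_extD (extD k α) x hx).trans ?_
  rw [hα.extDeriv_eq]
  exact extDeriv_extDeriv_apply (α.contDiffAt_inChart x hx) hr

theorem extD_wedge1 {θ : DiffForm E M 1} (hθ : extD 1 θ = 0) (α : DiffForm E M k) :
    extD (k + 1) (θ.wedge1 k α) = -θ.wedge1 (k + 1) (extD k α) := by
  refine DiffForm.ext_inChart fun x => ?_
  have hx := mem_extChartAt_target (I := 𝓘(ℝ, E)) x
  have hd : extDeriv (inChart θ x) (extChartAt 𝓘(ℝ, E) x x) = 0 := by
    rw [← inChart_extD θ x hx, hθ]; rfl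
  have hwedge : inChart (θ.wedge1 k α) x = fun z => wedgeOne (inChart θ x z) (inChart α x z) :=
    funext fun z => inChart_wedge1 _ _ _ _
  refine (inChart_extD _ x hx).trans
    (Eq.trans ?_ (congrArg Neg.neg (inChart_wedge1 θ (extD k α) x _).symm))
  rw [hwedge, inChart_extD _ x hx]
  exact extDeriv_wedgeOne ((θ.contDiffAt_inChart x hx).differentiableAt (by norm_num))
    ((α.contDiffAt_inChart x hx).differentiableAt (by norm_num)) hd

theorem subsingleton_diffForm [FiniteDimensional ℝ E] (hk : Module.finrank ℝ E < k) :
    Subsingleton (DiffForm E M k) :=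
  have := subsingleton_alt hk
  ⟨fun α β => DiffForm.ext fun x => Subsingleton.elim (α := Alt E k) (α x) (β x)⟩

end DifferentialForms

namespace Nondeg

variable {E : Type*} [NormedAddCommGroup E] [NormedSpace ℝ E] [FiniteDimensional ℝ E]

theorem comp {σ : Alt E 2} (hσ : Nondeg σ) {g : E →L[ℝ] E} (hg : Function.Surjective g) :
    Nondeg (σ.compContinuousLinearMap g) := by
  intro v hv
  have hinj : Function.Injective g :=
    (LinearMap.injective_iff_surjective (f := g.toLinearMap)).2 hg
  refine (map_eq_zero_iff g hinj).1 (hσ _ (hg.forall.2 fun w => ?_))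
  rw [← hv w, ContinuousAlternatingMap.compContinuousLinearMap_apply]
  congr 1
  ext i
  fin_cases i <;> rfl

end Nondeg

namespace LCSStructure

variable {E : Type*} [NormedAddCommGroup E] [NormedSpace ℝ E]
  {M : Type*} [TopologicalSpace M] [ChartedSpace E M] [IsManifold 𝓘(ℝ, E) ∞ M]
  (S : LCSStructure E M)

theorem d_d (l : ℤ) (j : ℕ) (α : DiffForm E M j) : S.d l (j + 1) (S.d l j α) = 0 := by
  have hθ : S.theta.wedge1 (j + 1) (S.theta.wedge1 j α) = 0 :=
    DiffForm.ext fun x => wedgeOne_wedgeOne_self (E := E) (S.theta x) (α x)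
  simp only [d, LinearMap.add_apply, LinearMap.smul_apply, map_add, map_smul, extD_extD,
    extD_wedge1 S.d_theta, hθ]
  module

theorem Lpow_apply (p j : ℕ) (α : DiffForm E M j) (x : M) :
    S.Lpow p j α x = wedgePow (E := E) (S.omega x) p j (α x) := by
  induction p with
  | zero => rfl
  | succ p ih => exact congrArg ((wedgeTwoL (E := E) (j + 2 * p)).flip (S.omega x)) ih

theorem nondeg (x : M) : Nondeg (E := E) (S.omega x) := S.nondegenerate x

variable [FiniteDimensional ℝ E]

theorem nondeg_inChart (x₀ : M) {y : E} (hy : y ∈ (extChartAt 𝓘(ℝ, E) x₀).target) :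
    Nondeg (inChart S.omega x₀ y) := by
  have hI : IsManifold 𝓘(ℝ, E) 1 M := IsManifold.of_le (n := ∞) (by norm_num)
  have hinv := mfderivWithin_extChartAt_symm_comp_mfderiv_extChartAt' (I := 𝓘(ℝ, E))
    ((extChartAt 𝓘(ℝ, E) x₀).map_target hy)
  simp only [modelWithCornersSelf_coe, Set.range_id, mfderivWithin_univ] at hinv
  rw [(extChartAt 𝓘(ℝ, E) x₀).right_inv hy] at hinv
  exact Nondeg.comp (E := E) (S.nondeg ((extChartAt 𝓘(ℝ, E) x₀).symm y))
    fun v => ⟨_, congrArg (fun f : E →L[ℝ] E => f v) hinv⟩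

theorem Lpow_injective {p j : ℕ} (hp : 2 * (j + p) ≤ Module.finrank ℝ E) :
    Function.Injective (S.Lpow p j) := fun α β h => DiffForm.ext fun x =>
  (S.nondeg x).wedgePow_injective hp <|
    (S.Lpow_apply p j α x).symm.trans
      ((congrArg (fun γ : DiffForm E M (j + 2 * p) => γ x) h).trans (S.Lpow_apply p j β x))

theorem contDiffAt_inverse_wedgePow {q j : ℕ} (hq : 2 * (j + q) = Module.finrank ℝ E) (x₀ : M) :
    ContDiffAt ℝ ∞ (fun y => (wedgePow (inChart S.omega x₀ y) q j).inverse)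
      (extChartAt 𝓘(ℝ, E) x₀ x₀) := by
  have hx := mem_extChartAt_target (I := 𝓘(ℝ, E)) x₀
  exact ContDiffAt.comp (g := ContinuousLinearMap.inverse)
    (f := fun y => wedgePow (inChart S.omega x₀ y) q j) _
    ((S.nondeg_inChart x₀ hx).wedgePow_isInvertible hq).contDiffAt_map_inverse
    ((contDiff_wedgePow (E := E) q j).contDiffAt.comp _ (S.omega.contDiffAt_inChart x₀ hx))

theorem Lpow_surjective {q j : ℕ} (hq : 2 * (j + q) = Module.finrank ℝ E) :
    Function.Surjective (S.Lpow q j) := by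
  intro γ
  let β : RawForm E M j := fun x =>
    (wedgePow (E := E) (S.omega x) q j).inverse (γ x : Alt E (j + 2 * q))
  have hβ : ∀ x, wedgePow (E := E) (S.omega x) q j (β x) = γ x := fun x =>
    ((S.nondeg x).wedgePow_isInvertible hq).self_apply_inverse _
  have hchart : ∀ x₀ y, wedgePow (inChart S.omega x₀ y) q j (inChart β x₀ y) = inChart γ x₀ y :=
    fun x₀ y => (wedgePow_comp (E := E) _ _ q j _).trans
      (congrArg (fun α : Alt E (j + 2 * q) => α.compContinuousLinearMap _) (hβ _))
  refine ⟨DiffForm.mkOf β fun x₀ => ?_, DiffForm.ext fun x => (S.Lpow_apply q j _ x).trans (hβ x)⟩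
  have hx := mem_extChartAt_target (I := 𝓘(ℝ, E)) x₀
  refine ((S.contDiffAt_inverse_wedgePow hq x₀).clm_apply
    (γ.contDiffAt_inChart x₀ hx)).congr_of_eventuallyEq ?_
  filter_upwards [(isOpen_extChartAt_target (I := 𝓘(ℝ, E)) x₀).mem_nhds hx] with y hy
  rw [← hchart, ((S.nondeg_inChart x₀ hy).wedgePow_isInvertible hq).inverse_apply_self]

end LCSStructure

theorem exists_linearMap_comp_eq {R P A B : Type*} [Ring R] [AddCommGroup P] [Module R P]
    [AddCommGroup A] [Module R A] [AddCommGroup B] [Module R B] {f : P →ₗ[R] A} {g : P →ₗ[R] B}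
    (hf : Function.Surjective f) (h : LinearMap.ker f ≤ LinearMap.ker g) :
    ∃ δ : A →ₗ[R] B, δ ∘ₗ f = g :=
  ⟨(LinearMap.ker f).liftQ g h ∘ₗ (f.quotKerEquivOfSurjective hf).symm.toLinearMap,
    LinearMap.ext fun x => by simp [LinearMap.quotKerEquivOfSurjective_symm_apply]⟩

theorem range_eq_map_range {R V V' W W' : Type*} [Ring R] [AddCommGroup V] [Module R V]
    [AddCommGroup V'] [Module R V'] [AddCommGroup W] [Module R W] [AddCommGroup W'] [Module R W']
    {d : V →ₗ[R] V'} {e : W →ₗ[R] W'} {f : V →ₗ[R] W} {f' : V' →ₗ[R] W'}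
    (hf : Function.Surjective f) (h : ∀ x, e (f x) = f' (d x)) :
    LinearMap.range e = (LinearMap.range d).map f' := by
  rw [← LinearMap.range_comp, ← (LinearMap.ext h : e ∘ₗ f = f' ∘ₗ d),
    LinearMap.range_comp_of_range_eq_top _ (LinearMap.range_eq_top.2 hf)]

namespace Cohomology

variable {V W : ℕ → Type*} [∀ j, AddCommGroup (V j)] [∀ j, Module ℝ (V j)]
  [∀ j, AddCommGroup (W j)] [∀ j, Module ℝ (W j)]
  (d : ∀ j, V j →ₗ[ℝ] V (j + 1)) {e : ∀ j, W j →ₗ[ℝ] W (j + 1)} {i j : ℕ}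

theorem mk_surjective (j : ℕ) : Function.Surjective (mk d j) := Submodule.mkQ_surjective _

theorem mk_eq_zero_iff (z : LinearMap.ker (d j)) :
    mk d j z = 0 ↔ (z : V j) ∈ coboundaries d j :=
  Submodule.Quotient.mk_eq_zero _

variable {d} {f : V i →ₗ[ℝ] W j} {hker : ∀ a ∈ LinearMap.ker (d i), f a ∈ LinearMap.ker (e j)}
  {hcob : ∀ a ∈ coboundaries d i, f a ∈ coboundaries e j}

theorem map_injective (hf : Function.Injective f)
    (h : coboundaries e j ≤ (coboundaries d i).map f) :
    Function.Injective (map d e f hker hcob) := by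
  refine (injective_iff_map_eq_zero _).2 ((mk_surjective d i).forall.2 fun a ha => ?_)
  have hfa : f a ∈ coboundaries e j := (mk_eq_zero_iff e ⟨f a, hker a a.2⟩).1 ha
  exact (mk_eq_zero_iff d a).2 (hf.mem_set_image.1 (h hfa))

theorem map_surjective (hf : Function.Surjective f)
    (h : ∀ a, f a ∈ LinearMap.ker (e j) → a ∈ LinearMap.ker (d i)) :
    Function.Surjective (map d e f hker hcob) := by
  refine (mk_surjective e j).forall.2 fun ⟨b, hb⟩ => ?_
  obtain ⟨a, rfl⟩ := hf b
  exact ⟨mk d i ⟨a, h a hb⟩, rfl⟩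

end Cohomology

namespace LCSStructure

variable {E : Type*} [NormedAddCommGroup E] [NormedSpace ℝ E]
  {M : Type*} [TopologicalSpace M] [ChartedSpace E M] [IsManifold 𝓘(ℝ, E) ∞ M]
  (S : LCSStructure E M)

section Filtration

theorem LpowTo_L (p : ℕ) : ∀ (j m : ℕ) (h : j + 2 + 2 * p = m) (h' : j + 2 * (p + 1) = m)
    (α : DiffForm E M j), S.LpowTo p (j + 2) m h (S.L j α) = S.LpowTo (p + 1) j m h' α := by
  induction p with
  | zero =>
    rintro j _ rfl _ α
    rfl
  | succ p ih =>
    rintro j _ rfl h' α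
    refine (S.LpowTo_succ p (j + 2) (j + 2 + 2 * p) rfl rfl _).trans ?_
    rw [ih j _ rfl (by omega)]
    exact (S.LpowTo_succ (p + 1) j (j + 2 + 2 * p) (by omega) h' α).symm

theorem filtration_eq_range_LpowTo (p : ℕ) : ∀ (j m : ℕ) (h : j + 2 * p = m),
    S.filtration p m = LinearMap.range (S.LpowTo p j m h) := by
  induction p with
  | zero =>
    rintro j _ rfl
    exact LinearMap.range_id.symm
  | succ p ih =>
    rintro j _ rfl
    exact (congrArg (Submodule.map _) (ih j _ rfl)).trans (LinearMap.range_comp _ _).symm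

theorem filtration_eq_bot {p m : ℕ} (hm : m < 2 * p) : S.filtration p m = ⊥ := by
  induction p generalizing m with
  | zero => omega
  | succ p ih =>
    match m with
    | 0 | 1 => rfl
    | m + 2 => exact (congrArg (Submodule.map _) (ih (by omega))).trans (Submodule.map_bot _)

theorem filtration_one_add_two (j : ℕ) : S.filtration 1 (j + 2) = LinearMap.range (S.L j) :=
  Submodule.map_top _

theorem L_mem_filtration_one {j : ℕ} (η : DiffForm E M j) : S.L j η ∈ S.filtration 1 (j + 2) :=
  ⟨η, trivial, rfl⟩

theorem map_d_filtration_one (l : ℤ) (j : ℕ) :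
    (S.filtration 1 (j + 1)).map (S.d l (j + 1)) = (coboundaries (S.d (l - 1)) j).map (S.L j) := by
  cases j with
  | zero => exact (Submodule.map_bot _).trans (Submodule.map_bot _).symm
  | succ j =>
    rw [filtration_one_add_two, coboundaries, ← LinearMap.range_comp, ← LinearMap.range_comp]
    exact congrArg LinearMap.range (LinearMap.ext (S.d_L l j))

end Filtration

section GradedPieces

theorem toE0_surjective (p j : ℕ) : Function.Surjective (S.toE0 p j) := by
  refine (Submodule.mkQ_surjective _).comp fun ⟨α, hα⟩ => ?_
  rw [S.filtration_eq_range_LpowTo p j (p + (p + j)) (by omega)] at hα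
  exact hα.imp fun β hβ => Subtype.ext hβ

theorem toE0_eq_zero_iff_LpowTo_mem (p j : ℕ) (α : DiffForm E M j) :
    S.toE0 p j α = 0 ↔
      S.LpowTo p j (p + (p + j)) (by omega) α ∈ S.filtration (p + 1) (p + (p + j)) :=
  Submodule.Quotient.mk_eq_zero _

theorem toE0_L (p j : ℕ) (η : DiffForm E M j) : S.toE0 p (j + 2) (S.L j η) = 0 := by
  rw [toE0_eq_zero_iff_LpowTo_mem, S.LpowTo_L p j _ _ (by omega)]
  exact S.LpowTo_mem _ _ _ _ _

theorem toE0_eq_zero (p : ℕ) {j : ℕ} {α : DiffForm E M j} (hα : α ∈ S.filtration 1 j) :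
    S.toE0 p j α = 0 := by
  match j, α, hα with
  | 0, α, hα | 1, α, hα => rw [(Submodule.mem_bot ℝ).1 hα, map_zero]
  | j + 2, _, ⟨η, _, rfl⟩ => exact S.toE0_L p j η

theorem toE0_eq_toE0 (p : ℕ) {j : ℕ} {α β : DiffForm E M j} (h : α - β ∈ S.filtration 1 j) :
    S.toE0 p j α = S.toE0 p j β :=
  sub_eq_zero.1 ((map_sub _ _ _).symm.trans (S.toE0_eq_zero p h))

theorem toE0_mem_ker_d0 {l : ℤ} (p : ℕ) {j : ℕ} {α : DiffForm E M j}
    (h : S.d l j α ∈ S.filtration 1 (j + 1)) :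
    S.toE0 p j α ∈ LinearMap.ker (S.d0 (l + p) p (p + j)) :=
  (S.d0_toE0 l p j α).trans (S.toE0_eq_zero p h)

theorem subsingleton_E0 {p q : ℕ} (hq : q < p) : Subsingleton (S.E0 p q) :=
  have : Subsingleton (S.filtration p (p + q)) := by
    rw [S.filtration_eq_bot (by omega)]; infer_instance
  (Submodule.mkQ_surjective _).subsingleton

theorem coboundaries_d0_self (l : ℤ) (p : ℕ) : coboundaries (S.d0 l p) p = ⊥ := by
  cases p with
  | zero => rfl
  | succ p =>
    have := S.subsingleton_E0 p.lt_succ_self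
    exact LinearMap.range_eq_bot.2 (Subsingleton.elim _ _)

theorem coboundaries_d0 (l : ℤ) (p j : ℕ) :
    coboundaries (S.d0 (l + p) p) (p + j) = (coboundaries (S.d l) j).map (S.toE0 p j) := by
  cases j with
  | zero => exact (S.coboundaries_d0_self _ p).trans (Submodule.map_bot _).symm
  | succ j => exact range_eq_map_range (S.toE0_surjective p j) (S.d0_toE0 l p j)

end GradedPieces

section KernelOfGradedProjection

variable [FiniteDimensional ℝ E]

theorem LpowTo_injective {p j m : ℕ} (h : j + 2 * p = m) (hp : 2 * (j + p) ≤ Module.finrank ℝ E) :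
    Function.Injective (S.LpowTo p j m h) := by
  subst h
  exact S.Lpow_injective hp

theorem LpowTo_surjective {q j m : ℕ} (h : j + 2 * q = m)
    (hq : 2 * (j + q) = Module.finrank ℝ E) : Function.Surjective (S.LpowTo q j m h) := by
  subst h
  exact S.Lpow_surjective hq

theorem L_injective {j : ℕ} (hj : 2 * (j + 1) ≤ Module.finrank ℝ E) :
    Function.Injective (S.L j) :=
  S.Lpow_injective (p := 1) hj

theorem d_eq_zero_of_d_L_eq_zero {l : ℤ} {j : ℕ} (hj : 2 * (j + 2) ≤ Module.finrank ℝ E)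
    {η : DiffForm E M j} (h : S.d l (j + 2) (S.L j η) = 0) : S.d (l - 1) j η = 0 :=
  (map_eq_zero_iff _ (S.L_injective hj)).1 ((S.d_L l j η).symm.trans h)

theorem ker_toE0 {p j : ℕ} (hp : 2 * (j + p) ≤ Module.finrank ℝ E) :
    LinearMap.ker (S.toE0 p j) = S.filtration 1 j := by
  refine le_antisymm (fun α hα => ?_) fun α => S.toE0_eq_zero p
  have hinj := S.LpowTo_injective (m := p + (p + j)) (by omega) hp
  have hmem := (S.toE0_eq_zero_iff_LpowTo_mem p j α).1 hα
  match j, α, hinj, hmem with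
  | 0, α, hinj, hmem | 1, α, hinj, hmem =>
    rw [S.filtration_eq_bot (by omega), Submodule.mem_bot] at hmem
    exact (Submodule.mem_bot ℝ).2 ((map_eq_zero_iff _ hinj).1 hmem)
  | j + 2, α, hinj, hmem =>
    rw [S.filtration_eq_range_LpowTo (p + 1) j _ (by omega)] at hmem
    obtain ⟨γ, hγ⟩ := hmem
    rw [← S.LpowTo_L p j _ (by omega)] at hγ
    exact ⟨γ, trivial, hinj hγ⟩

theorem toE0_injective {p j : ℕ} (hj : j < 2) (hp : 2 * (j + p) ≤ Module.finrank ℝ E) :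
    Function.Injective (S.toE0 p j) :=
  LinearMap.ker_eq_bot.1 ((S.ker_toE0 hp).trans (S.filtration_eq_bot (by omega)))

theorem toE0_mem_ker_d0_iff {l : ℤ} {p j : ℕ} (hp : 2 * (j + 1 + p) ≤ Module.finrank ℝ E)
    {α : DiffForm E M j} :
    S.toE0 p j α ∈ LinearMap.ker (S.d0 (l + p) p (p + j)) ↔
      S.d l j α ∈ S.filtration 1 (j + 1) := by
  rw [← S.ker_toE0 hp, LinearMap.mem_ker, LinearMap.mem_ker]
  exact Eq.congr_left (S.d0_toE0 l p j α)

theorem toE0_mem_coboundaries_iff {l : ℤ} {p j : ℕ} (hp : 2 * (j + p) ≤ Module.finrank ℝ E)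
    {α : DiffForm E M j} :
    S.toE0 p j α ∈ coboundaries (S.d0 (l + p) p) (p + j) ↔
      α ∈ coboundaries (S.d l) j ⊔ S.filtration 1 j := by
  rw [S.coboundaries_d0, ← S.ker_toE0 hp, ← Submodule.comap_map_eq, Submodule.mem_comap]

theorem LbarP_injective (l : ℤ) {p j : ℕ} (hj : j < 2) (hp : 2 * (j + p) ≤ Module.finrank ℝ E) :
    Function.Injective (S.LbarP l p j) :=
  Cohomology.map_injective (S.toE0_injective hj hp) (S.coboundaries_d0 l p j).le

theorem LbarP_zero_surjective (l : ℤ) {p : ℕ} (hp : 2 * (1 + p) ≤ Module.finrank ℝ E) :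
    Function.Surjective (S.LbarP l p 0) :=
  Cohomology.map_surjective (S.toE0_surjective p 0) fun _ ha =>
    (Submodule.mem_bot ℝ).1 ((S.toE0_mem_ker_d0_iff hp).1 ha)

end KernelOfGradedProjection

section PrimitiveForms

/-- The map `𝒫^j → E_0^{p,p+j}`, `a ↦ [L^p a]`. -/
def primToE0 (n p j : ℕ) : S.primitive n j →ₗ[ℝ] S.E0 p (p + j) :=
  (S.toE0 p j).domRestrict (S.primitive n j)

variable [FiniteDimensional ℝ E] {n : ℕ} (hn : Module.finrank ℝ E = 2 * n)
include hn

theorem primitive_eq_top {k : ℕ} (hk : k < 2) (hkn : k ≤ n) : S.primitive n k = ⊤ := by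
  have : Subsingleton (DiffForm E M (k + 2 * (n - k + 1))) := subsingleton_diffForm (by omega)
  rw [primitive, if_pos hkn, Subsingleton.elim (S.Lpow (n - k + 1) k) 0, LinearMap.ker_zero]

theorem isCompl_primitive {k : ℕ} (hk : k ≤ n) :
    IsCompl (S.primitive n k) (S.filtration 1 k) := by
  match k with
  | 0 | 1 => exact (S.primitive_eq_top hn (by omega) hk).symm ▸ isCompl_top_bot
  | k + 2 =>
    -- `L ^ r` kills primitive forms, while `L ^ r ∘ L = L ^ (r + 1)` is bijective on `Ω ^ k`.
    set r := n - (k + 2) + 1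
    have hL : ∀ β, S.Lpow r (k + 2) (S.L k β) = S.LpowTo (r + 1) k _ (by omega) β :=
      S.LpowTo_L r k (k + 2 + 2 * r) rfl (by omega)
    rw [primitive, if_pos hk, filtration_one_add_two]
    refine ⟨Submodule.disjoint_def.2 ?_, Submodule.codisjoint_iff_exists_add_eq.2 fun α => ?_⟩
    · rintro _ hα ⟨β, rfl⟩
      have hinj := S.LpowTo_injective (p := r + 1) (j := k) (m := k + 2 + 2 * r) (by omega)
        (by omega)
      rw [(map_eq_zero_iff _ hinj).1 ((hL β).symm.trans hα), map_zero]
    · obtain ⟨β, hβ⟩ := S.LpowTo_surjective (q := r + 1) (j := k) (by omega) (by omega)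
        (S.Lpow r (k + 2) α)
      refine ⟨α - S.L k β, S.L k β, ?_, ⟨β, rfl⟩, sub_add_cancel _ _⟩
      rw [LinearMap.mem_ker, map_sub, hL, hβ, sub_self]

theorem sub_primProj_mem {k : ℕ} (hk : k ≤ n) (α : DiffForm E M k) :
    α - S.primProj n k α ∈ S.filtration 1 k := by
  rw [primProj, dif_pos (S.isCompl_primitive hn hk)]
  exact Submodule.sub_projection_mem _ α

theorem primToE0_bijective {p j : ℕ} (hp : j + p ≤ n) :
    Function.Bijective (S.primToE0 n p j) := by
  refine ⟨LinearMap.injective_domRestrict_iff.2 ?_, fun z => ?_⟩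
  · rw [S.ker_toE0 (by omega)]
    exact (S.isCompl_primitive hn (by omega)).disjoint
  · obtain ⟨α, rfl⟩ := S.toE0_surjective p j z
    exact ⟨S.primProj n j α, (S.toE0_eq_toE0 p (S.sub_primProj_mem hn (by omega) α)).symm⟩

theorem d0_primToE0 (l : ℤ) (p : ℕ) {j : ℕ} (hj : j + 1 ≤ n) (a : S.primitive n j) :
    S.d0 (l + p) p (p + j) (S.primToE0 n p j a) = S.primToE0 n p (j + 1) (S.dplus n l j a) :=
  (S.d0_toE0 l p j a).trans (S.toE0_eq_toE0 p (S.sub_primProj_mem hn hj (S.d l j a)))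

theorem primToE0_mem_ker_d0_iff {l : ℤ} {p j : ℕ} (hp : j + 1 + p ≤ n) {a : S.primitive n j} :
    S.primToE0 n p j a ∈ LinearMap.ker (S.d0 (l + p) p (p + j)) ↔
      a ∈ LinearMap.ker (S.dplus n l j) := by
  rw [LinearMap.mem_ker, S.d0_primToE0 hn l p (by omega)]
  exact map_eq_zero_iff _ (S.primToE0_bijective hn hp).1

theorem coboundaries_d0_eq_map_primToE0 (l : ℤ) {p j : ℕ} (hp : j + p ≤ n) :
    coboundaries (S.d0 (l + p) p) (p + j) =
      (coboundaries (S.dplus n l) j).map (S.primToE0 n p j) := by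
  cases j with
  | zero => exact (S.coboundaries_d0_self _ p).trans (Submodule.map_bot _).symm
  | succ j =>
    exact range_eq_map_range (S.primToE0_bijective hn (by omega)).2
      (S.d0_primToE0 hn l p (by omega))

theorem exists_primitive_equiv (l : ℤ) {p j : ℕ} (hp : p + j + 1 ≤ n) :
    ∃ Φ : Cohomology (S.dplus n l) j ≃ₗ[ℝ] S.E1 (l + p) p (p + j),
      ∀ a : LinearMap.ker (S.dplus n l j),
        ∃ z : LinearMap.ker (S.d0 (l + p) p (p + j)),
          (z : S.E0 p (p + j)) = S.toE0 p j a ∧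
          Φ (Cohomology.mk (S.dplus n l) j a) = Cohomology.mk (S.d0 (l + p) p) (p + j) z := by
  have hbij := S.primToE0_bijective hn (show j + p ≤ n by omega)
  have hker : ∀ a, S.primToE0 n p j a ∈ LinearMap.ker (S.d0 (l + p) p (p + j)) ↔
      a ∈ LinearMap.ker (S.dplus n l j) :=
    fun a => S.primToE0_mem_ker_d0_iff hn (by omega)
  have hcob := S.coboundaries_d0_eq_map_primToE0 hn l (show j + p ≤ n by omega)
  exact ⟨.ofBijective (Cohomology.map _ _ (S.primToE0 n p j) (fun a => (hker a).2)
      fun a ha => hcob.ge (Submodule.mem_map_of_mem ha))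
    ⟨Cohomology.map_injective hbij.1 hcob.le,
      Cohomology.map_surjective hbij.2 fun a => (hker a).1⟩,
    fun a => ⟨⟨S.primToE0 n p j a, (hker a).2 a.2⟩, rfl, rfl⟩⟩

end PrimitiveForms

section ConnectingHomomorphism

/-- The pairs `(α, η)` with `d_l α = L η` and `d_{l-1} η = 0`, from which the connecting
homomorphism `[L^p α] ↦ [η]` is read off. -/
def connectingPairs (l : ℤ) (j : ℕ) :
    Submodule ℝ (DiffForm E M (j + 1) × LinearMap.ker (S.d (l - 1) j)) :=
  LinearMap.eqLocus (S.d l (j + 1) ∘ₗ LinearMap.fst ℝ _ _)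
    (S.L j ∘ₗ (LinearMap.ker (S.d (l - 1) j)).subtype ∘ₗ LinearMap.snd ℝ _ _)

/-- The cocycle `[L^p α]` of `E_0^{p,p+j+1}` attached to a pair `(α, η)` with `d_l α = L η`. -/
def pairToCocycle (l : ℤ) (p j : ℕ) :
    S.connectingPairs l j →ₗ[ℝ] LinearMap.ker (S.d0 (l + p) p (p + (j + 1))) :=
  (S.toE0 p (j + 1) ∘ₗ LinearMap.fst ℝ _ _ ∘ₗ (S.connectingPairs l j).subtype).codRestrict _
    fun x => S.toE0_mem_ker_d0 p ((x.2 : S.d l (j + 1) x.1.1 = _) ▸ S.L_mem_filtration_one _)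

variable [FiniteDimensional ℝ E]

theorem pairToCocycle_surjective (l : ℤ) {p j : ℕ}
    (hp : 2 * (p + j + 2) ≤ Module.finrank ℝ E) :
    Function.Surjective (S.pairToCocycle l p j) := by
  rintro ⟨z, hz⟩
  obtain ⟨α, rfl⟩ := S.toE0_surjective p (j + 1) z
  obtain ⟨η, -, hη⟩ := (S.toE0_mem_ker_d0_iff (by omega)).1 hz
  have hdη : S.d (l - 1) j η = 0 := S.d_eq_zero_of_d_L_eq_zero (by omega) (by rw [hη, d_d])
  exact ⟨⟨(α, ⟨η, hdη⟩), hη.symm⟩, rfl⟩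

theorem mem_coboundaries_of_d_eq_L {l : ℤ} {p j : ℕ} (hp : 2 * (p + j + 1) ≤ Module.finrank ℝ E)
    {α : DiffForm E M (j + 1)} {η : DiffForm E M j} (h : S.d l (j + 1) α = S.L j η)
    (hα : S.toE0 p (j + 1) α ∈ coboundaries (S.d0 (l + p) p) (p + (j + 1))) :
    η ∈ coboundaries (S.d (l - 1)) j := by
  obtain ⟨_, ⟨γ, rfl⟩, φ, hφ, rfl⟩ :=
    Submodule.mem_sup.1 ((S.toE0_mem_coboundaries_iff (by omega)).1 hα)
  rw [map_add, d_d, zero_add] at h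
  have hL : S.L j η ∈ (coboundaries (S.d (l - 1)) j).map (S.L j) :=
    S.map_d_filtration_one l j ▸ ⟨φ, hφ, h⟩
  exact (S.L_injective (by omega)).mem_set_image.1 hL

theorem exists_isConnecting (l : ℤ) {p j : ℕ} (hp : 2 * (p + j + 2) ≤ Module.finrank ℝ E) :
    ∃ δ : S.E1 (l + p) p (p + (j + 1)) →ₗ[ℝ] S.H (l - 1) j, S.IsConnecting l p j δ := by
  have hsurj := S.pairToCocycle_surjective l hp
  obtain ⟨δ, hδ⟩ := exists_linearMap_comp_eq
    (f := Cohomology.mk (S.d0 (l + p) p) (p + (j + 1)) ∘ₗ S.pairToCocycle l p j)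
    (g := Cohomology.mk (S.d (l - 1)) j ∘ₗ LinearMap.snd ℝ _ _ ∘ₗ (S.connectingPairs l j).subtype)
    ((Cohomology.mk_surjective _ _).comp hsurj) fun x hx =>
      (Cohomology.mk_eq_zero_iff _ _).2
        (S.mem_coboundaries_of_d_eq_L (by omega) x.2 ((Cohomology.mk_eq_zero_iff _ _).1 hx))
  refine ⟨δ, fun z => ⟨?_, fun α η hz h => ?_⟩⟩
  · obtain ⟨x, rfl⟩ := hsurj z
    exact ⟨x.1.1, x.1.2, rfl, x.2⟩
  · obtain rfl : S.pairToCocycle l p j ⟨(α, η), h⟩ = z := Subtype.ext hz.symm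
    exact LinearMap.congr_fun hδ ⟨(α, η), h⟩

end ConnectingHomomorphism

section LongExactSequence

variable {S} in
theorem IsConnecting.exact_right {l : ℤ} {p j : ℕ}
    {δ : S.E1 (l + p) p (p + (j + 1)) →ₗ[ℝ] S.H (l - 1) j} (hδ : S.IsConnecting l p j δ) :
    Function.Exact δ (S.Lbar l j) := by
  refine (Cohomology.mk_surjective _ _).forall.2 fun η => ⟨fun hη => ?_, ?_⟩
  · obtain ⟨α, hα⟩ := (Cohomology.mk_eq_zero_iff (S.d l) (j := j + 2) _).1 hη
    exact ⟨Cohomology.mk _ _ ⟨S.toE0 p (j + 1) α, S.toE0_mem_ker_d0 p ⟨η, trivial, hα.symm⟩⟩,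
      (hδ _).2 α η rfl hα⟩
  · rintro ⟨y, hy⟩
    rw [← hy]
    obtain ⟨z, rfl⟩ := Cohomology.mk_surjective _ _ y
    obtain ⟨⟨α, η', hz, hα⟩, hval⟩ := hδ z
    rw [hval α η' hz hα]
    exact (Cohomology.mk_eq_zero_iff (S.d l) (j := j + 2) _).2 ⟨α, hα⟩

variable {S} in
theorem IsConnecting.exact_left {l : ℤ} {p j : ℕ}
    {δ : S.E1 (l + p) p (p + (j + 1)) →ₗ[ℝ] S.H (l - 1) j} (hδ : S.IsConnecting l p j δ) :
    Function.Exact (S.LbarP l p (j + 1)) δ := by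
  refine (Cohomology.mk_surjective _ _).forall.2 fun z => ⟨fun hz => ?_, ?_⟩
  · obtain ⟨⟨α, η, hzα, hα⟩, hval⟩ := hδ z
    rw [hval α η hzα hα, Cohomology.mk_eq_zero_iff] at hz
    -- Correct `α` by some `φ ∈ L Ω` with `d φ = L η` to get a closed form with the same image.
    obtain ⟨φ, hφ, hdφ⟩ : S.L j η ∈ (S.filtration 1 (j + 1)).map (S.d l (j + 1)) :=
      S.map_d_filtration_one l j ▸ Submodule.mem_map_of_mem hz
    have hclosed : S.d l (j + 1) (α - φ) = 0 := by rw [map_sub, hα, hdφ, sub_self]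
    have hE0 : S.toE0 p (j + 1) (α - φ) = S.toE0 p (j + 1) α :=
      S.toE0_eq_toE0 p (by rw [sub_sub_cancel_left]; exact neg_mem hφ)
    exact ⟨Cohomology.mk (S.d l) (j + 1) ⟨α - φ, hclosed⟩,
      congrArg (Cohomology.mk (S.d0 (l + p) p) (p + (j + 1))) (Subtype.ext (hE0.trans hzα.symm))⟩
  · rintro ⟨y, hy⟩
    rw [← hy]
    obtain ⟨β, rfl⟩ := Cohomology.mk_surjective _ _ y
    exact ((hδ _).2 β 0 rfl (β.2.trans (map_zero (S.L j)).symm)).trans (map_zero _)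

theorem Lbar_LbarP_exact [FiniteDimensional ℝ E] (l : ℤ) {p j : ℕ}
    (hp : 2 * (p + j + 2) ≤ Module.finrank ℝ E) :
    Function.Exact (S.Lbar l j) (S.LbarP l p (j + 2)) := by
  refine (Cohomology.mk_surjective _ _).forall.2 fun β => ⟨fun hβ => ?_, ?_⟩
  · obtain ⟨γ', ⟨γ, rfl⟩, _, ⟨η, -, rfl⟩, hsum⟩ := Submodule.mem_sup.1 <|
      (S.toE0_mem_coboundaries_iff (by omega)).1 <|
        (Cohomology.mk_eq_zero_iff (S.d0 (l + p) p) (j := p + (j + 2)) _).1 hβ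
    have hη : S.L j η = β - S.d l (j + 1) γ := eq_sub_of_add_eq' hsum
    have hdη : S.d (l - 1) j η = 0 := S.d_eq_zero_of_d_L_eq_zero (by omega) <| by
      rw [hη, map_sub, d_d, sub_zero, LinearMap.mem_ker.1 β.2]
    have hcob : S.d l (j + 1) (-γ) = S.L j η - β := by rw [map_neg, hη, sub_sub_cancel_left]
    exact ⟨Cohomology.mk _ _ ⟨η, hdη⟩, sub_eq_zero.1 <|
      (Cohomology.mk_eq_zero_iff (S.d l) (j := j + 2) (⟨S.L j η, _⟩ - β)).2 ⟨-γ, hcob⟩⟩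
  · rintro ⟨y, hy⟩
    rw [← hy]
    obtain ⟨η, rfl⟩ := Cohomology.mk_surjective _ _ y
    have h0 : S.toE0 p (j + 2) (S.L j η) ∈ coboundaries (S.d0 (l + p) p) (p + (j + 2)) :=
      (S.toE0_L p j η).symm ▸ zero_mem _
    exact (Cohomology.mk_eq_zero_iff (S.d0 (l + p) p) (j := p + (j + 2)) ⟨_, _⟩).2 h0

end LongExactSequence

end LCSStructure

end LCS

end

theorem theorem4p4_general {E M : Type*} [NormedAddCommGroup E] [NormedSpace ℝ E]
    [FiniteDimensional ℝ E] {n : ℕ} (hn : Module.finrank ℝ E = 2 * n) [TopologicalSpace M]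
    [ChartedSpace E M] [IsManifold 𝓘(ℝ, E) ∞ M] (S : LCSStructure E M) (l : ℤ) :
    (∀ k ≤ n, IsCompl (S.primitive n k) (S.filtration 1 k)) ∧
    (∀ p j : ℕ, p + j + 1 ≤ n →
      ∃ Φ : Cohomology (S.dplus n l) j ≃ₗ[ℝ] S.E1 (l + p) p (p + j),
        ∀ a : LinearMap.ker (S.dplus n l j),
          ∃ z : LinearMap.ker (S.d0 (l + p) p (p + j)),
            (z : S.E0 p (p + j)) = S.toE0 p j a ∧
            Φ (Cohomology.mk (S.dplus n l) j a) = Cohomology.mk (S.d0 (l + p) p) (p + j) z) ∧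
    (∀ p : ℕ, p + 1 ≤ n →
      Function.Bijective (S.LbarP l p 0) ∧ Function.Injective (S.LbarP l p 1)) ∧
    (∀ p j : ℕ, p + j + 2 ≤ n →
      ∃ δ : S.E1 (l + p) p (p + (j + 1)) →ₗ[ℝ] S.H (l - 1) j,
        S.IsConnecting l p j δ ∧
        Function.Exact (S.LbarP l p (j + 1)) δ ∧
        Function.Exact δ (S.Lbar l j) ∧
        Function.Exact (S.Lbar l j) (S.LbarP l p (j + 2))) := by
  refine ⟨fun k hk => S.isCompl_primitive hn hk, fun p j hp => S.exists_primitive_equiv hn l hp,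
    fun p hp => ⟨⟨S.LbarP_injective l (by omega) (by omega), S.LbarP_zero_surjective l (by omega)⟩,
      S.LbarP_injective l (by omega) (by omega)⟩,
    fun p j hp => ?_⟩
  obtain ⟨δ, hδ⟩ := S.exists_isConnecting l (p := p) (j := j) (by omega)
  exact ⟨δ, hδ, hδ.exact_left, hδ.exact_right, S.Lbar_LbarP_exact l (by omega)⟩

theorem theorem4p4 (n : ℕ) (M : Type*) [TopologicalSpace M]
    [ChartedSpace (EuclideanSpace ℝ (Fin (2 * n))) M]
    [IsManifold 𝓘(ℝ, EuclideanSpace ℝ (Fin (2 * n))) ∞ M]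
    (S : LCSStructure (EuclideanSpace ℝ (Fin (2 * n))) M) (l : ℤ) :
    (∀ k ≤ n, IsCompl (S.primitive n k) (S.filtration 1 k)) ∧
    (∀ p j : ℕ, p + j + 1 ≤ n →
      ∃ Φ : Cohomology (S.dplus n l) j ≃ₗ[ℝ] S.E1 (l + p) p (p + j),
        ∀ a : LinearMap.ker (S.dplus n l j),
          ∃ z : LinearMap.ker (S.d0 (l + p) p (p + j)),
            (z : S.E0 p (p + j)) = S.toE0 p j a ∧
            Φ (Cohomology.mk (S.dplus n l) j a) = Cohomology.mk (S.d0 (l + p) p) (p + j) z) ∧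
    (∀ p : ℕ, p + 1 ≤ n →
      Function.Bijective (S.LbarP l p 0) ∧ Function.Injective (S.LbarP l p 1)) ∧
    (∀ p j : ℕ, p + j + 2 ≤ n →
      ∃ δ : S.E1 (l + p) p (p + (j + 1)) →ₗ[ℝ] S.H (l - 1) j,
        S.IsConnecting l p j δ ∧
        Function.Exact (S.LbarP l p (j + 1)) δ ∧
        Function.Exact δ (S.Lbar l j) ∧
        Function.Exact (S.Lbar l j) (S.LbarP l p (j + 2))) :=
  theorem4p4_general finrank_euclideanSpace_fin S l
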